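/- Let $\mathbb F_q$ be a finite field with $q$ elements, $A=\mathbb F_q[t]$, $F=\mathbb F_q(t)$, $F_\infty=\mathbb F_q((1/t))$ the completion of $F$ for $|f/g|=q^{\deg f-\deg g}$, and $\mathbb C_\infty$ the completion of an algebraic closure of $F_\infty$. Let $A_+\subset A$ be the set of monic polynomials. A prime on a product means that it runs over non-zero elements only. Let $r\ge 2$ and fix $0\ne\xi\in\mathbb C_\infty$ (for instance a generator of the lattice of the Carlitz module). For $n\ge1$ let $\Omega^n$ be the set of column vectors $\omega=(\omega_1,\dots,\omega_n)\in\mathbb C_\infty^n$ with $F_\infty$-linearly independent entries and $\omega_n=\xi$; for $k\in\mathbb N$ let $$\Omega^n_k=\{\omega\in\Omega^n : |\omega|_i\ge q^{-k}|\omega|\},\quad |\omega|=\max_j|\omega_j|,\quad |\omega|_i=\inf\{|h_1\omega_1+\dots+h_n\omega_n| : h_j\in F_\infty,\ \max_j|h_j|=1\}.$$ For a lattice $L=A^n\omega=A\omega_1+\dots+A\omega_n$ put $e_L(X)=X\prod'_{\lambda\in L}(1-X/\lambda)$ and, for $0\neq a\in A$, $\varphi^L_a(Z)=aZ\prod'_{\lambda\in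 a^{-1}L/L}(1-Z/e_L(\lambda))$. Let $\Delta(\omega)$ be the leading coefficient of $\varphi_t^{A^r\omega}$ for $\omega\in\Omega^r$. For $\omega'\in\Omega^{r-1}$ let $\varphi=\varphi^{A^{r-1}\omega'}$, let $\Delta'_a(\omega')$ be the leading coefficient of $\varphi_a$, $\Delta'=\Delta'_t$, and $$f_a(X)=X^{q^{(r-1)\deg a}}\,\Delta'_a(\omega')^{-1}\varphi_a(X^{-1})-1,$$ a polynomial in $X$ with coefficients depending on $\omega'$. For $\omega\in\Omega^r$ write $\omega'=(\omega_2,\dots,\omega_r)$ and $u=e_{A^{r-1}\omega'}(\omega_1)^{-1}$. Then $f_{cp}=f_p$ for all $c\in\mathbb F_q^\times$ and $0\ne p\in A$, and the $u$-expansion of $\Delta$ is given by a product over monic polynomials: $$\Delta(\omega)=-\Delta'(\omega')^q\,u^{q-1}\prod_{a\in A_+}\bigl(1+f_a(u)\bigr)^{(q^r-1)(q-1)} .$$ Precisely: (i) for every $\omega'\in\Omega^{r-1}$ the product $\prod_{a\in A_+}(1+f_a(X))^{(q^r-1)(q-1)}$ converges $X$-adically to a formal power series $G_{\omega'}(X)\in\mathbb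 C_\infty[[X]]$; (ii) for every $k\in\mathbb N$ there is $\rho_k>0$ such that the product $\prod_{a\in A_+}(1+f_a(u))^{(q^r-1)(q-1)}$ converges uniformly for $(u,\omega')\in\{|u|<\rho_k\}\times\Omega^{r-1}_k$, and for every $\omega\in\Omega^r$ with $\omega'\in\Omega^{r-1}_k$ and $|u|<\rho_k$ the displayed formula holds and $\Delta(\omega)$ is the sum of the convergent power series $-\Delta'(\omega')^q X^{q-1}G_{\omega'}(X)$ at $X=u$. If $r=2$ and $\xi$ generates the lattice of the Carlitz module (that is, $\varphi_t^{A\xi}(Z)=tZ+Z^q$), then $\Delta'=1$. -/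

import Mathlib

open Polynomial Filter Topology

noncomputable section

namespace DrinfeldDisc

/-! Throughout, `Fq` is a finite field with `q = Fintype.card Fq` elements, `A = Fq[X]` (the
variable `X` is the `t` of the mathematics) and `F = RatFunc Fq`. -/

section Fields

variable (Fq : Type*) [Field Fq] [Fintype Fq]

lemma one_lt_card : (1 : ℝ) < (Fintype.card Fq : ℝ) := by
  exact_mod_cast Fintype.one_lt_card (α := Fq)

open Classical in
/-- The absolute value `|f / g| = q ^ (deg f - deg g)` on `F = Fq(t)`. -/
def absInfty : AbsoluteValue (RatFunc Fq) ℝ where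
  toFun x := if x = 0 then 0 else (Fintype.card Fq : ℝ) ^ x.intDegree
  map_mul' x y := by
    have h0 : (Fintype.card Fq : ℝ) ≠ 0 := (zero_lt_one.trans (one_lt_card Fq)).ne'
    by_cases hx : x = 0
    · simp [hx]
    by_cases hy : y = 0
    · simp [hy]
    simp [hx, hy, RatFunc.intDegree_mul hx hy, zpow_add₀ h0]
  nonneg' x := by
    split_ifs <;> positivity
  eq_zero' x := by
    have h0 : (Fintype.card Fq : ℝ) ≠ 0 := (zero_lt_one.trans (one_lt_card Fq)).ne'
    by_cases hx : x = 0
    · simp [hx]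
    · simpa [hx] using zpow_ne_zero _ h0
  add_le' x y := by
    have h1 := (one_lt_card Fq).le
    have h2 : ∀ n : ℤ, (0 : ℝ) ≤ (Fintype.card Fq : ℝ) ^ n := fun n => by positivity
    by_cases hx : x = 0
    · simp [hx]
    by_cases hy : y = 0
    · simp [hy]
    by_cases hxy : x + y = 0
    · simp only [hxy, hx, hy, if_true, if_false]
      exact add_nonneg (h2 _) (h2 _)
    simp only [hx, hy, hxy, if_false]
    rcases le_max_iff.1 (RatFunc.intDegree_add_le hy hxy) with h | h
    · exact (zpow_le_zpow_right₀ h1 h).trans (le_add_of_nonneg_right (h2 _))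
    · exact (zpow_le_zpow_right₀ h1 h).trans (le_add_of_nonneg_left (h2 _))

lemma absInfty_of_ne_zero {x : RatFunc Fq} (hx : x ≠ 0) :
    absInfty Fq x = (Fintype.card Fq : ℝ) ^ x.intDegree :=
  if_neg hx

lemma absInfty_add_le_max (x y : RatFunc Fq) :
    absInfty Fq (x + y) ≤ max (absInfty Fq x) (absInfty Fq y) := by
  by_cases hx : x = 0
  · simp [hx]
  by_cases hy : y = 0
  · simp [hy]
  by_cases hxy : x + y = 0
  · rw [hxy, map_zero]
    exact le_max_of_le_left ((absInfty Fq).nonneg x)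
  have h1 := (one_lt_card Fq).le
  rw [absInfty_of_ne_zero Fq hx, absInfty_of_ne_zero Fq hy, absInfty_of_ne_zero Fq hxy]
  rcases le_max_iff.1 (RatFunc.intDegree_add_le hy hxy) with h | h
  · exact le_max_of_le_left (zpow_le_zpow_right₀ h1 h)
  · exact le_max_of_le_right (zpow_le_zpow_right₀ h1 h)

/-- `F_∞ = Fq((1/t))`, the completion of `F` for `absInfty`. -/
abbrev FInfty := (absInfty Fq).Completion

instance : IsUltrametricDist (FInfty Fq) := by
  apply IsUltrametricDist.isUltrametricDist_of_forall_norm_add_le_max_norm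
  intro x y
  induction x, y using UniformSpace.Completion.induction_on₂ with
  | hp => exact isClosed_le (by fun_prop) (by fun_prop)
  | ih a b =>
    rw [← UniformSpace.Completion.coe_add]
    simp only [UniformSpace.Completion.norm_coe]
    exact absInfty_add_le_max Fq a.ofAbs b.ofAbs

instance : NontriviallyNormedField (FInfty Fq) where
  non_trivial := by
    refine ⟨((WithAbs.toAbs (absInfty Fq) RatFunc.X : WithAbs (absInfty Fq)) : FInfty Fq), ?_⟩
    rw [UniformSpace.Completion.norm_coe]
    change 1 < absInfty Fq RatFunc.X
    rw [absInfty_of_ne_zero Fq RatFunc.X_ne_zero, RatFunc.intDegree_X, zpow_one]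
    exact one_lt_card Fq

/-- A fixed algebraic closure of `F_∞`. -/
abbrev AlgClInfty := AlgebraicClosure (FInfty Fq)

/-- The absolute value of `F_∞` extended to its algebraic closure. -/
instance : NormedField (AlgClInfty Fq) := spectralNorm.normedField (FInfty Fq) (AlgClInfty Fq)

instance : NormedAlgebra (FInfty Fq) (AlgClInfty Fq) := spectralNorm.normedAlgebra _ _

/-- `C_∞`, the completion of the algebraic closure of `F_∞`. -/
abbrev CInfty := UniformSpace.Completion (AlgClInfty Fq)

/-- The embedding `A = Fq[t] → C_∞`. -/
def ofPoly : Fq[X] →+* CInfty Fq :=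
  (algebraMap (FInfty Fq) (CInfty Fq)).comp <|
    (UniformSpace.Completion.coeRingHom (α := WithAbs (absInfty Fq))).comp <|
      (WithAbs.equiv (absInfty Fq)).symm.toRingHom.comp (algebraMap Fq[X] (RatFunc Fq))

end Fields

section Exponential

variable {Fq : Type*} [Field Fq] [Fintype Fq]

/-- The exponential function `e_L(x) = x ∏' (1 - x / λ)` of `L ⊆ C_∞`, the product being over the
non-zero elements `λ` of `L`. -/
def expL (L : AddSubgroup (CInfty Fq)) (x : CInfty Fq) : CInfty Fq :=
  x * ∏' l : {l : CInfty Fq // l ∈ L ∧ l ≠ 0}, (1 - x / (l : CInfty Fq))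

/-- The additive group `a⁻¹ L = {z | a z ∈ L}`. -/
def invMul (a : Fq[X]) (L : AddSubgroup (CInfty Fq)) : AddSubgroup (CInfty Fq) :=
  L.comap (AddMonoidHom.mulLeft (ofPoly Fq a))

/-- The polynomial `φ^L_a(Z) = a Z ∏' (1 - Z / e_L(λ))`, the product being over the non-zero classes
`λ` in the (finite) quotient `a⁻¹ L / L`. The value `e_L(λ)` does not depend on the representative of
the class. -/
def drinfeldPoly (L : AddSubgroup (CInfty Fq)) (a : Fq[X]) : (CInfty Fq)[X] :=
  C (ofPoly Fq a) * X *
    ∏ᶠ c : {c : invMul a L ⧸ L.addSubgroupOf (invMul a L) // c ≠ 0},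
      (1 - C (expL L ((c : invMul a L ⧸ L.addSubgroupOf (invMul a L)).out : CInfty Fq))⁻¹ * X)

/-- The lattice `A^n ω = A ω_1 + ⋯ + A ω_n`. -/
def lattice {n : ℕ} (ω : Fin n → CInfty Fq) : AddSubgroup (CInfty Fq) where
  carrier := Set.range fun a : Fin n → Fq[X] => ∑ i, ofPoly Fq (a i) * ω i
  zero_mem' := ⟨0, by simp⟩
  add_mem' := by
    rintro _ _ ⟨a, rfl⟩ ⟨b, rfl⟩
    exact ⟨a + b, by simp [add_mul, Finset.sum_add_distrib]⟩
  neg_mem' := by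
    rintro _ ⟨a, rfl⟩
    exact ⟨-a, by simp⟩

/-- `Δ_a(ω)`: the leading coefficient of `φ^ω_a`. -/
def leadCoeff {n : ℕ} (a : Fq[X]) (ω : Fin n → CInfty Fq) : CInfty Fq :=
  (drinfeldPoly (lattice ω) a).leadingCoeff

/-- The period domain `Ω^n`: vectors that lie on no `F_∞`-hyperplane, normalized so that the last
entry is `ξ`. -/
def periodDomain (ξ : CInfty Fq) (n : ℕ) : Set (Fin n → CInfty Fq) :=
  {ω | LinearIndependent (FInfty Fq) ω ∧ ∀ i : Fin n, (i : ℕ) + 1 = n → ω i = ξ}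

/-- `|ω|_i = inf |h_1 ω_1 + ⋯ + h_n ω_n|` over the linear forms with coefficients `h_j` in `F_∞`
and `max |h_j| = 1`. (The norm on `Fin n → F_∞` is the maximum norm.) -/
def hyperplaneDist {n : ℕ} (ω : Fin n → CInfty Fq) : ℝ :=
  ⨅ h : {h : Fin n → FInfty Fq // ‖h‖ = 1},
    ‖∑ j, algebraMap (FInfty Fq) (CInfty Fq) ((h : Fin n → FInfty Fq) j) * ω j‖

/-- `Ω^n_k = {ω ∈ Ω^n | |ω|_i ≥ q^{-k} |ω|}`, where `|ω| = max |ω_j|`. -/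
def periodDomainLevel (ξ : CInfty Fq) (n k : ℕ) : Set (Fin n → CInfty Fq) :=
  {ω | ω ∈ periodDomain ξ n ∧ ((Fintype.card Fq : ℝ) ^ k)⁻¹ * ‖ω‖ ≤ hyperplaneDist ω}

/-- The parameter `u_{ω'}(z) = e_{A^m ω'}(z)⁻¹`. -/
def uParam {m : ℕ} (ω' : Fin m → CInfty Fq) (z : CInfty Fq) : CInfty Fq :=
  (expL (lattice ω') z)⁻¹

/-- The polynomial `f_a(X) = X^{q^{m deg a}} Δ'_a(ω')⁻¹ φ_a(X⁻¹) - 1`, where `φ` is the Drinfeld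
module of the lattice `A^m ω'`; here `Polynomial.reflect N φ_a` is `X^N φ_a(X⁻¹)`. -/
def fPoly {m : ℕ} (ω' : Fin m → CInfty Fq) (a : Fq[X]) : (CInfty Fq)[X] :=
  C (leadCoeff a ω')⁻¹ *
    (drinfeldPoly (lattice ω') a).reflect (Fintype.card Fq ^ (m * a.natDegree)) - 1

/-- `ξ` is a generator of the lattice of the Carlitz module, i.e. `ξ ≠ 0` and the Drinfeld module
of the lattice `A ξ` is given by `φ_t(Z) = t Z + Z^q`. -/
def IsCarlitzGenerator (ξ : CInfty Fq) : Prop :=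
  ξ ≠ 0 ∧ drinfeldPoly (lattice ![ξ]) (X : Fq[X]) =
    C (ofPoly Fq X) * X + X ^ Fintype.card Fq

end Exponential

end DrinfeldDisc

end

open DrinfeldDisc

/-! Write `L' = A^m ω'` with `m = r - 1`, `e = e_{L'}`, `D = Δ'(ω')`, and let `L` be the lattice of
`ω`. The lattice `L` is the union of the cosets `a ω_1 + L'`, so `e_L(y) = e(y) R(y)` with `R(y) =
∏_{a ≠ 0} (1 + e(y) / e(a ω_1))` (`StronglyDiscrete.hasProd_latExp`). On the other hand `Δ(ω)` times
the product of `e_L(-λ)` over the non-trivial `t`-division points `λ` modulo `L` equals `t`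
(`leadingCoeff_mulPoly_mul`). Inserting the first formula into the second splits that product into
one of values of `e` and one of values of `R`.

The first is computed by grouping the `λ` by their `ω_1`-coordinate `b / t`. Each group is a value
of `e(t y)` up to the factor `D`, and Wilson's theorem gives `-t D^{-q} e(ω_1)^{q-1}`
(`leadOf_pow_mul_prod_latExp`).

For the second put `g(a) = 1 + f_a(u) = Δ'_a^{-1} u^{q^{m deg a}} e(a ω_1)` and `g(0) = 1`. The same
grouping, with `Δ'_{ta+b} = D Δ'_a^{q^m}`, shows that the factor belonging to `a`, multiplied by
`g(a)^{q^r}`, is `∏_b g(ta + b)` (`prod_coset_factor`). As `ta + b` runs once through `A`, the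
product `P = ∏ g(a)` satisfies `(∏_λ R(-λ)) P^{q^r} = P`. Hence `Δ = -D^q u^{q-1} P^{q^r - 1}`
(`leadOf_eq_tprod`), and `g(ca) = g(a)` reduces `P` to monic polynomials with exponent `q - 1`.

Convergence rests on two properties of `1 + f_a(X) = ∏ (1 - e(λ) X)`, the product being over `a^{-1}
L' / L'`. Additivity of `φ_a` leaves only exponents that are powers of the characteristic, so `f_a`
starts at half its formal degree or later (`coeff_reversedPoly_eq_zero`). The points `λ` have
representatives bounded on `Ω_k`, so `|e(λ)| ≤ M` with `M` depending only on `k`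
(`exists_norm_latExp_le`), and the `j`-th coefficient is at most `M^j`. The radius `1 / (2M)` then
works. -/

noncomputable section

namespace DrinfeldDisc

/-! ### Infinite products over an ultrametric field -/

section UltrametricProducts

variable {K : Type*} [NormedField K] {ι : Type*}

lemma finite_setOf_le_norm_sub_one {f : ι → K} (hf : Tendsto f cofinite (𝓝 1)) {ε : ℝ}
    (hε : 0 < ε) : {i | ε ≤ ‖f i - 1‖}.Finite := by
  have h := (Metric.tendsto_nhds.1 hf) ε hε
  simpa [dist_eq_norm, Filter.eventually_cofinite] using h

lemma hasProd_norm_le_pow {f : ι → K} {a : K} (h : HasProd f a) (T : Finset ι) {c : ℝ}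
    (hc : 1 ≤ c) (hT : ∀ i ∈ T, ‖f i‖ ≤ c) (hT' : ∀ i ∉ T, ‖f i‖ ≤ 1) : ‖a‖ ≤ c ^ T.card := by
  classical
  have h' : Tendsto (fun t : Finset ι => ∏ i ∈ t, f i) atTop (𝓝 a) := by
    simpa [HasProd] using h
  refine le_of_tendsto h'.norm (Eventually.of_forall fun t => ?_)
  rw [norm_prod]
  calc ∏ i ∈ t, ‖f i‖ ≤ ∏ i ∈ t, (if i ∈ T then c else 1) := by
        refine Finset.prod_le_prod (fun _ _ => norm_nonneg _) fun i _ => ?_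
        split_ifs with hi
        exacts [hT i hi, hT' i hi]
    _ = c ^ (t.filter (· ∈ T)).card := by
        rw [Finset.prod_ite, Finset.prod_const, Finset.prod_const_one, mul_one]
    _ ≤ c ^ T.card := by
        refine pow_le_pow_right₀ hc (Finset.card_le_card fun i hi => (Finset.mem_filter.1 hi).2)

variable [IsUltrametricDist K]

/-- The identity `xy - 1 = (x - 1)(y - 1) + (x - 1) + (y - 1)` and the ultrametric inequality keep
the same bound however many factors there are. -/
lemma norm_prod_sub_one_le (s : Finset ι) (f : ι → K) {δ : ℝ} (h0 : 0 ≤ δ) (h1 : δ ≤ 1)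
    (h : ∀ i ∈ s, ‖f i - 1‖ ≤ δ) : ‖∏ i ∈ s, f i - 1‖ ≤ δ := by
  classical
  induction s using Finset.induction_on with
  | empty => simpa
  | insert i s hi ih =>
    rw [Finset.prod_insert hi]
    have ha := h i (Finset.mem_insert_self _ _)
    have hb := ih fun j hj => h j (Finset.mem_insert_of_mem hj)
    have e : f i * ∏ j ∈ s, f j - 1 =
        (f i - 1) * (∏ j ∈ s, f j - 1) + ((f i - 1) + (∏ j ∈ s, f j - 1)) := by ring
    rw [e]
    refine (IsUltrametricDist.norm_add_le_max _ _).trans (max_le ?_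
      ((IsUltrametricDist.norm_add_le_max _ _).trans (max_le ha hb)))
    rw [norm_mul]
    exact (mul_le_mul ha hb (norm_nonneg _) h0).trans (mul_le_of_le_one_right h0 h1)

lemma norm_eq_one_of_norm_sub_one_lt {x : K} (h : ‖x - 1‖ < 1) : ‖x‖ = 1 := by
  have e : ‖(x - 1) + 1‖ = max ‖x - 1‖ ‖(1 : K)‖ :=
    IsUltrametricDist.norm_add_eq_max_of_norm_ne_norm (by rw [norm_one]; exact h.ne)
  rw [sub_add_cancel, norm_one, max_eq_right h.le] at e
  exact e

lemma norm_prod_sub_prod_le {s t : Finset ι} (hst : s ⊆ t) (f : ι → K) {δ : ℝ} (h0 : 0 ≤ δ)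
    (h1 : δ ≤ 1) (h : ∀ i ∉ s, ‖f i - 1‖ ≤ δ) :
    ‖∏ i ∈ t, f i - ∏ i ∈ s, f i‖ ≤ ‖∏ i ∈ s, f i‖ * δ := by
  classical
  rw [← Finset.prod_sdiff hst,
    show (∏ i ∈ t \ s, f i) * ∏ i ∈ s, f i - ∏ i ∈ s, f i
      = (∏ i ∈ s, f i) * (∏ i ∈ t \ s, f i - 1) by ring, norm_mul]
  exact mul_le_mul_of_nonneg_left
    (norm_prod_sub_one_le _ _ h0 h1 fun i hi => h i (Finset.mem_sdiff.1 hi).2) (norm_nonneg _)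

/-- In a product whose factors tend to `1`, the norms of the finite subproducts are eventually
constant. -/
lemma exists_norm_prod_eq {f : ι → K} (hf : Tendsto f cofinite (𝓝 1)) :
    ∃ s : Finset ι, ∀ t, s ⊆ t → ‖∏ i ∈ t, f i‖ = ‖∏ i ∈ s, f i‖ := by
  classical
  refine ⟨(finite_setOf_le_norm_sub_one hf one_pos).toFinset, fun t ht => ?_⟩
  rw [← Finset.prod_sdiff ht, norm_mul, norm_prod, Finset.prod_eq_one, one_mul]
  intro i hi
  refine norm_eq_one_of_norm_sub_one_lt ?_
  simpa using (Finset.mem_sdiff.1 hi).2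

/-- Once the norm of the partial products has stabilized at `C`, adding factors within `δ` of `1`
moves a partial product by at most `C δ`. No summability is needed. -/
theorem multipliable_of_tendsto_one [CompleteSpace K] {f : ι → K}
    (hf : Tendsto f cofinite (𝓝 1)) : Multipliable f := by
  classical
  obtain ⟨s, hs⟩ := exists_norm_prod_eq hf
  set C := ‖∏ i ∈ s, f i‖ with hC
  have hC0 : 0 ≤ C := norm_nonneg _
  suffices h : CauchySeq fun t : Finset ι => ∏ i ∈ t, f i by
    obtain ⟨a, ha⟩ := cauchySeq_tendsto_of_complete h
    exact ⟨a, by simpa [HasProd] using ha⟩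
  rw [Metric.cauchySeq_iff']
  intro ε hε
  set δ := min (ε / (C + 1)) 1 with hδ
  have hδ0 : 0 < δ := lt_min (by positivity) one_pos
  refine ⟨s ∪ (finite_setOf_le_norm_sub_one hf hδ0).toFinset, fun t ht => ?_⟩
  rw [dist_eq_norm]
  refine (norm_prod_sub_prod_le ht f hδ0.le (min_le_right _ _) fun i hi => ?_).trans_lt ?_
  · have : i ∉ (finite_setOf_le_norm_sub_one hf hδ0).toFinset :=
      fun h => hi (Finset.mem_union_right _ h)
    simp only [Set.Finite.mem_toFinset, Set.mem_ofPred_eq, not_le] at this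
    exact this.le
  · rw [hs _ Finset.subset_union_left]
    calc C * δ ≤ C * (ε / (C + 1)) := mul_le_mul_of_nonneg_left (min_le_left _ _) hC0
      _ < (C + 1) * (ε / (C + 1)) := by
        apply mul_lt_mul_of_pos_right (lt_add_one C); positivity
      _ = ε := by field_simp

theorem hasProd_ne_zero_of_tendsto_one {f : ι → K} {a : K} (h : HasProd f a)
    (hf : Tendsto f cofinite (𝓝 1)) (h0 : ∀ i, f i ≠ 0) : a ≠ 0 := by
  obtain ⟨s, hs⟩ := exists_norm_prod_eq hf
  have h' : Tendsto (fun t : Finset ι => ‖∏ i ∈ t, f i‖) atTop (𝓝 ‖a‖) :=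
    (show Tendsto (fun t : Finset ι => ∏ i ∈ t, f i) atTop (𝓝 a) by
      simpa [HasProd] using h).norm
  have h'' : Tendsto (fun t : Finset ι => ‖∏ i ∈ t, f i‖) atTop (𝓝 ‖∏ i ∈ s, f i‖) :=
    tendsto_const_nhds.congr' ((eventually_ge_atTop s).mono fun t ht => (hs t ht).symm)
  rw [← norm_ne_zero_iff, tendsto_nhds_unique h' h'', norm_ne_zero_iff]
  exact Finset.prod_ne_zero_iff.2 fun i _ => h0 i

/-- With all factors of norm at most `1`, the constant `C` of the pointwise argument can be taken to
be `1` for every point, which makes the estimate uniform. -/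
theorem multipliableUniformlyOn_of_finite [CompleteSpace K] {X : Type*} {f : ι → X → K}
    {s : Set X} (h1 : ∀ i, ∀ x ∈ s, ‖f i x‖ ≤ 1)
    (h : ∀ ε : ℝ, 0 < ε → {i | ∃ x ∈ s, ε ≤ ‖f i x - 1‖}.Finite) :
    MultipliableUniformlyOn f s := by
  classical
  have hm : ∀ x ∈ s, Multipliable (f · x) := fun x hx => by
    refine multipliable_of_tendsto_one (Metric.tendsto_nhds.2 fun ε hε => ?_)
    rw [Filter.eventually_cofinite]
    refine (h ε hε).subset fun i hi => ⟨x, hx, ?_⟩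
    simpa [dist_eq_norm] using hi
  refine HasProdUniformlyOn.multipliableUniformlyOn (g := fun x => ∏' i, f i x) ?_
  rw [hasProdUniformlyOn_iff_tendstoUniformlyOn, Metric.tendstoUniformlyOn_iff]
  intro ε hε
  set δ := min (ε / 2) 1 with hδ
  have hδ0 : 0 < δ := lt_min (by positivity) one_pos
  filter_upwards [eventually_ge_atTop (h δ hδ0).toFinset] with S hS x hx
  rw [dist_eq_norm]
  have ht : Tendsto (fun T : Finset ι => ‖∏ i ∈ T, f i x - ∏ i ∈ S, f i x‖) atTop
      (𝓝 ‖∏' i, f i x - ∏ i ∈ S, f i x‖) :=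
    ((show Tendsto (fun T : Finset ι => ∏ i ∈ T, f i x) atTop (𝓝 _) by
      simpa [HasProd] using (hm x hx).hasProd).sub_const _).norm
  refine lt_of_le_of_lt (le_of_tendsto ht ((eventually_ge_atTop S).mono fun T hT => ?_))
    (half_lt_self hε)
  refine (norm_prod_sub_prod_le hT (f · x) hδ0.le (min_le_right _ _) fun i hi => ?_).trans ?_
  · have : i ∉ (h δ hδ0).toFinset := fun h => hi (hS h)
    simp only [Set.Finite.mem_toFinset, Set.mem_ofPred_eq, not_exists, not_and, not_le] at this
    exact (this x hx).le
  · refine (mul_le_of_le_one_left hδ0.le ?_).trans (min_le_left _ _)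
    rw [norm_prod]
    exact Finset.prod_le_one (fun _ _ => norm_nonneg _) fun i _ => h1 i x hx

end UltrametricProducts

/-! ### The exponential function of a strongly discrete subgroup -/

section LatticeExponential

/-- A subgroup of a normed field with finite intersection with every ball. -/
def StronglyDiscrete {K : Type*} [NormedField K] (L : AddSubgroup K) : Prop :=
  ∀ R : ℝ, {x | x ∈ L ∧ ‖x‖ ≤ R}.Finite

/-- The exponential function of `L`, over an arbitrary normed field. -/
def latExp {K : Type*} [NormedField K] (L : AddSubgroup K) (x : K) : K :=
  x * ∏' l : {l : K // l ∈ L ∧ l ≠ 0}, (1 - x / (l : K))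

variable {K : Type*} [NormedField K] {L M : AddSubgroup K}

lemma tendsto_one_sub_div {ι : Type*} {l : ι → K} (hl : ∀ R : ℝ, {i | ‖l i‖ ≤ R}.Finite) (z : K) :
    Tendsto (fun i => 1 - z / l i) cofinite (𝓝 1) := by
  refine Metric.tendsto_nhds.2 fun ε hε => ?_
  rw [Filter.eventually_cofinite]
  refine (hl (‖z‖ / ε)).subset fun i hi => ?_
  simp only [dist_eq_norm, Set.mem_ofPred_eq, not_lt, sub_sub_cancel_left, norm_neg,
    norm_div] at hi ⊢
  rcases eq_or_ne (l i) 0 with h0 | h0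
  · rw [h0, norm_zero, div_zero] at hi
    exact absurd hi (not_le.2 hε)
  · rw [le_div_iff₀ hε]
    rwa [le_div_iff₀ (norm_pos_iff.2 h0), mul_comm] at hi

lemma StronglyDiscrete.finite_coset (hL : StronglyDiscrete L) (c : K) (R : ℝ) :
    {l : L | ‖c + l‖ ≤ R}.Finite := by
  refine ((hL (R + ‖c‖)).preimage Subtype.val_injective.injOn).subset fun l hl => ⟨l.2, ?_⟩
  calc ‖(l : K)‖ = ‖(c + l) - c‖ := by rw [add_sub_cancel_left]
    _ ≤ ‖c + l‖ + ‖c‖ := norm_sub_le _ _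
    _ ≤ R + ‖c‖ := by gcongr; exact hl

lemma StronglyDiscrete.finite_subtype (hL : StronglyDiscrete L) (R : ℝ) :
    {l : L | ‖(l : K)‖ ≤ R}.Finite := by
  simpa using hL.finite_coset 0 R

lemma StronglyDiscrete.mono (hM : StronglyDiscrete M) (h : L ≤ M) : StronglyDiscrete L :=
  fun R => (hM R).subset fun _ hx => ⟨h hx.1, hx.2⟩

/-- As `x / 0 = 0`, the factor of `0` may be included. -/
lemma latExp_eq_tprod (x : K) : latExp L x = x * ∏' l : L, (1 - x / (l : K)) := by
  rw [latExp]
  congr 1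
  let g : {l : K // l ∈ L ∧ l ≠ 0} → L := fun l => ⟨l, l.2.1⟩
  have hg : Function.Injective g := fun a b h => Subtype.ext (congrArg (fun l : L => (l : K)) h)
  refine hg.tprod_eq (f := fun l : L => 1 - x / (l : K)) fun l hl => ?_
  by_contra hn
  refine hl ?_
  have : (l : K) = 0 := by
    by_contra h0
    exact hn ⟨⟨l, l.2, h0⟩, rfl⟩
  simp [this]

lemma latExp_of_mem {x : K} (hx : x ∈ L) : latExp L x = 0 := by
  rcases eq_or_ne x 0 with rfl | h0
  · simp [latExp]
  · rw [latExp, (hasProd_zero_of_exists_eq_zero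
      ⟨⟨x, hx, h0⟩, by simp [div_self h0]⟩).tprod_eq, mul_zero]

/-- The product of `z - v` over a finite subgroup is additive in `z`. -/
lemma prod_sub_add (V : AddSubgroup K) (s : Finset K) (hs : ∀ x, x ∈ s ↔ x ∈ V) (x y : K) :
    ∏ v ∈ s, (x + y - v) = ∏ v ∈ s, (x - v) + ∏ v ∈ s, (y - v) := by
  set r : K[X] := ∏ v ∈ s, (X - C v) with hr
  have hmon : r.Monic := monic_prod_of_monic _ _ fun v _ => monic_X_sub_C v
  have heval : ∀ z, r.eval z = ∏ v ∈ s, (z - v) := fun z => by simp [hr, eval_prod]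
  have hdeg : r.natDegree = s.card := by simp [hr]
  have h0 : (0 : K) ∈ s := (hs 0).2 V.zero_mem
  have hzero : ∀ v ∈ s, r.eval v = 0 := fun v hv => by
    rw [heval]; exact Finset.prod_eq_zero hv (sub_self v)
  have hper : ∀ v ∈ s, r.eval (v + y) = r.eval y := fun v hv => by
    rw [heval, heval]
    refine Finset.prod_bij' (fun w _ => w - v) (fun w _ => w + v) ?_ ?_ ?_ ?_ ?_
    · exact fun w hw => (hs _).2 (V.sub_mem ((hs _).1 hw) ((hs _).1 hv))
    · exact fun w hw => (hs _).2 (V.add_mem ((hs _).1 hw) ((hs _).1 hv))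
    · intros; ring
    · intros; ring
    · intros; ring
  have hpos : 0 < s.card := Finset.card_pos.2 ⟨0, h0⟩
  have hdr : r.degree = s.card := by rw [degree_eq_natDegree hmon.ne_zero, hdeg]
  have hdr0 : r.degree ≠ 0 := by rw [hdr]; exact_mod_cast hpos.ne'
  -- Both `r(X + y)` and `r` are monic of degree `|V|`, so the difference of the two sides has
  -- smaller degree; it vanishes on the `|V|` points of `V` because `r` is `V`-periodic.
  have key : taylor y r = r + C (r.eval y) := by
    refine eq_of_degree_sub_lt_of_eval_finset_eq s ?_ fun v hv => ?_
    · rw [← hdr, ← sub_sub]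
      have h1 : (taylor y r - r).degree < r.degree := by
        have := degree_sub_lt_left (p := taylor y r) (q := r) (by rw [degree_taylor])
          (by rw [Ne, taylor_eq_zero]; exact hmon.ne_zero) (by rw [leadingCoeff_taylor])
        rwa [degree_taylor] at this
      refine (degree_sub_le _ _).trans_lt (max_lt h1 ?_)
      exact degree_C_le.trans_lt (by rw [hdr]; exact_mod_cast hpos)
    · rw [taylor_eval, eval_add, eval_C, hzero v hv, zero_add, hper v hv]
  have := congrArg (eval x) key
  rwa [taylor_eval, eval_add, eval_C, heval, heval, heval] at this

lemma mul_prod_add (V : AddSubgroup K) (s : Finset K) (hs : ∀ x, x ∈ s ↔ x ∈ V) (x y : K) :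
    (x + y) * ∏ v ∈ s, (1 - (x + y) / v) =
      x * ∏ v ∈ s, (1 - x / v) + y * ∏ v ∈ s, (1 - y / v) := by
  classical
  have h0 : (0 : K) ∈ s := (hs 0).2 V.zero_mem
  have key : ∀ z : K, z * ∏ v ∈ s, (1 - z / v) =
      (∏ v ∈ s.erase 0, (-v⁻¹)) * ∏ v ∈ s, (z - v) := fun z => by
    rw [← Finset.mul_prod_erase s (fun v => 1 - z / v) h0, ← Finset.mul_prod_erase s (fun v => z - v) h0, div_zero,
      sub_zero, one_mul, sub_zero, mul_left_comm, ← Finset.prod_mul_distrib]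
    congr 1
    refine Finset.prod_congr rfl fun v hv => ?_
    have : v ≠ 0 := Finset.ne_of_mem_erase hv
    field_simp
    ring
  rw [key, key, key, prod_sub_add V s hs, mul_add]

variable [IsUltrametricDist K] [CompleteSpace K]

lemma StronglyDiscrete.multipliable (hL : StronglyDiscrete L) (z c : K) :
    Multipliable fun l : L => 1 - z / (c + l) :=
  multipliable_of_tendsto_one (tendsto_one_sub_div (hL.finite_coset c) z)

lemma StronglyDiscrete.multipliable' (hL : StronglyDiscrete L) (z : K) :
    Multipliable fun l : L => 1 - z / (l : K) :=
  multipliable_of_tendsto_one (tendsto_one_sub_div hL.finite_subtype z)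

lemma StronglyDiscrete.latExp_eq_zero (hL : StronglyDiscrete L) {z : K} :
    latExp L z = 0 ↔ z ∈ L := by
  refine ⟨fun h => ?_, latExp_of_mem⟩
  by_contra hz
  have hz0 : z ≠ 0 := fun h0 => hz (h0 ▸ L.zero_mem)
  rw [latExp_eq_tprod] at h
  refine mul_ne_zero hz0 (hasProd_ne_zero_of_tendsto_one (hL.multipliable' z).hasProd
    (tendsto_one_sub_div hL.finite_subtype z) fun l => ?_) h
  rcases eq_or_ne (l : K) 0 with h0 | h0
  · simp [h0]
  · rw [sub_ne_zero]
    intro h1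
    rw [eq_div_iff h0, one_mul] at h1
    exact hz (h1 ▸ l.2)

/-- The subgroup of the elements of `L` of norm at most `R`. -/
def ballSubgroup (L : AddSubgroup K) (R : ℝ) (hR : 0 ≤ R) : AddSubgroup K where
  carrier := {x | x ∈ L ∧ ‖x‖ ≤ R}
  zero_mem' := ⟨L.zero_mem, by simpa⟩
  add_mem' ha hb := ⟨L.add_mem ha.1 hb.1,
    (IsUltrametricDist.norm_add_le_max _ _).trans (max_le ha.2 hb.2)⟩
  neg_mem' ha := ⟨L.neg_mem ha.1, by simpa using ha.2⟩

/-- Balls in `L` are finite subgroups, by the ultrametric inequality. Exhausting `L` by them lets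
additivity pass from finite subgroups to the limit. -/
lemma StronglyDiscrete.tendsto_latExp (hL : StronglyDiscrete L) (z : K) :
    Tendsto (fun n : ℕ => z * ∏ v ∈ (hL n).toFinset, (1 - z / v)) atTop (𝓝 (latExp L z)) := by
  rw [latExp_eq_tprod]
  refine Tendsto.const_mul z ?_
  have h : Tendsto (fun s : Finset L => ∏ l ∈ s, (1 - z / (l : K))) atTop
      (𝓝 (∏' l : L, (1 - z / (l : K)))) := by
    simpa [HasProd] using (hL.multipliable' z).hasProd
  have ht : Tendsto (fun n : ℕ => (hL.finite_subtype n).toFinset) atTop atTop := by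
    refine tendsto_atTop_finset_of_monotone (fun m n hmn l hl => ?_) fun l => ?_
    · simp only [Set.Finite.mem_toFinset, Set.mem_ofPred_eq] at hl ⊢
      exact hl.trans (by exact_mod_cast hmn)
    · obtain ⟨n, hn⟩ := exists_nat_ge ‖(l : K)‖
      exact ⟨n, by simpa using hn⟩
  refine (h.comp ht).congr fun n => ?_
  refine Finset.prod_bij (fun l _ => (l : K)) ?_ ?_ ?_ ?_
  · intro l hl
    simp only [Set.Finite.mem_toFinset, Set.mem_ofPred_eq] at hl ⊢
    exact ⟨l.2, hl⟩
  · exact fun _ _ _ _ h => Subtype.ext h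
  · intro v hv
    simp only [Set.Finite.mem_toFinset, Set.mem_ofPred_eq] at hv
    exact ⟨⟨v, hv.1⟩, by simpa using hv.2, rfl⟩
  · exact fun _ _ => rfl

theorem StronglyDiscrete.latExp_add (hL : StronglyDiscrete L) (x y : K) :
    latExp L (x + y) = latExp L x + latExp L y := by
  refine tendsto_nhds_unique (hL.tendsto_latExp (x + y))
    (((hL.tendsto_latExp x).add (hL.tendsto_latExp y)).congr fun n => ?_)
  exact (mul_prod_add (ballSubgroup L n n.cast_nonneg) _
    (fun v => by simp only [Set.Finite.mem_toFinset]; rfl) x y).symm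

/-- The exponential function as an additive map. -/
def StronglyDiscrete.expHom (hL : StronglyDiscrete L) : K →+ K :=
  AddMonoidHom.mk' (latExp L) hL.latExp_add

lemma StronglyDiscrete.latExp_sub (hL : StronglyDiscrete L) (x y : K) :
    latExp L (x - y) = latExp L x - latExp L y := map_sub hL.expHom x y

lemma StronglyDiscrete.latExp_neg (hL : StronglyDiscrete L) (x : K) :
    latExp L (-x) = -latExp L x := map_neg hL.expHom x

lemma StronglyDiscrete.latExp_eq_of_sub_mem (hL : StronglyDiscrete L) {x y : K}
    (h : x - y ∈ L) : latExp L x = latExp L y := by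
  rw [← sub_eq_zero, ← hL.latExp_sub, latExp_of_mem h]

lemma StronglyDiscrete.norm_latExp_of_lt (hL : StronglyDiscrete L) {x : K}
    (h : ∀ l ∈ L, l ≠ 0 → ‖x‖ < ‖l‖) : ‖latExp L x‖ = ‖x‖ := by
  rw [latExp_eq_tprod, norm_mul, (hL.multipliable' x).norm_tprod]
  have : ∀ l : L, ‖1 - x / (l : K)‖ = 1 := fun l => by
    rcases eq_or_ne (l : K) 0 with h0 | h0
    · simp [h0]
    · refine norm_eq_one_of_norm_sub_one_lt ?_
      rw [sub_sub_cancel_left, norm_neg, norm_div, div_lt_one (norm_pos_iff.2 h0)]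
      exact h l l.2 h0
  simp [this]

/-- `rep` is a system of representatives of `M` modulo `L`. -/
def IsTransversal {K : Type*} [AddCommGroup K] (L M : AddSubgroup K) {Q : Type*} (rep : Q → K) :
    Prop :=
  (∀ c, rep c ∈ M) ∧ ∀ x ∈ M, ∃! c, x - rep c ∈ L

/-- The bijection `(c, l) ↦ rep c + l` from `Q × L` to `M`. -/
def IsTransversal.equiv {Q : Type*} {rep : Q → K} (h : IsTransversal L M rep) (hLM : L ≤ M) :
    (Σ _ : Q, L) ≃ M :=
  Equiv.ofBijective (fun x => ⟨rep x.1 + x.2, M.add_mem (h.1 _) (hLM x.2.2)⟩) <| by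
    constructor
    · rintro ⟨c, l⟩ ⟨c', l'⟩ heq
      have heq' : rep c + l = rep c' + l' := congrArg Subtype.val heq
      have hc : c = c' := by
        refine (h.2 (rep c + l) (M.add_mem (h.1 _) (hLM l.2))).unique ?_ ?_
        · simp
        · rw [heq']; simp
      subst hc
      have : l = l' := Subtype.ext (add_left_cancel heq')
      rw [this]
    · intro x
      obtain ⟨c, hc, -⟩ := h.2 x x.2
      exact ⟨⟨c, ⟨_, hc⟩⟩, Subtype.ext (add_sub_cancel _ _)⟩

/-- After `l ↦ -l`, the factor `1 - z / (c - l)` times `1 - c / l` is `1 - (c - z) / l` for `l ≠ 0`.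
So the product is `e(c - z) / e(c)`, and additivity finishes. -/
lemma StronglyDiscrete.tprod_coset (hL : StronglyDiscrete L) {c : K} (hc : c ∉ L) (z : K) :
    ∏' l : L, (1 - z / (c + l)) = 1 - latExp L z / latExp L c := by
  classical
  have hc0 : latExp L c ≠ 0 := fun h => hc (hL.latExp_eq_zero.1 h)
  have hc1 : c ≠ 0 := fun h => hc (h ▸ L.zero_mem)
  have e : 1 - latExp L z / latExp L c = latExp L (c - z) / latExp L c := by
    rw [hL.latExp_sub, sub_div, div_self hc0]
  have hm := (hL.multipliable z c).hasProd
  have h1 := (hL.multipliable' c).hasProd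
  have h2 := (hL.multipliable' (c - z)).hasProd
  rw [← (Equiv.neg L).hasProd_iff] at hm
  -- the product over the non-zero elements and the factor of zero are compared separately
  have h3 : HasProd (fun l : L => if (l : K) = 0 then (c - z) / c else 1) ((c - z) / c) := by
    convert hasProd_single (f := fun l : L => if (l : K) = 0 then (c - z) / c else 1) 0 ?_ using 1
    · simp
    · intro l hl
      exact if_neg fun h => hl (Subtype.ext h)
  have h4 := (hm.mul h1)
  have h5 := (h3.mul h2)
  have h6 : ∀ l : L, ((fun l : L => 1 - z / (c + l)) ∘ Equiv.neg L) l * (1 - c / (l : K)) =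
      (if (l : K) = 0 then (c - z) / c else 1) * (1 - (c - z) / (l : K)) := fun l => by
    simp only [Function.comp, Equiv.neg_apply, AddSubgroup.coe_neg]
    split_ifs with h
    · simp [h]; field_simp
    · have : c + -(l : K) ≠ 0 := fun h' => hc (by
        rw [← sub_eq_add_neg, sub_eq_zero] at h'; exact h' ▸ l.2)
      field_simp
      ring
  have h7 := h4.unique (h5.congr_fun h6)
  rw [e, eq_div_iff hc0, latExp_eq_tprod, latExp_eq_tprod, mul_left_comm, h7]
  field_simp

/-- The exponential function of `M` in terms of that of a subgroup `L`; the factor of the trivial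
class is `1`, as `x / 0 = 0`. -/
theorem StronglyDiscrete.hasProd_latExp (hM : StronglyDiscrete M) (hLM : L ≤ M) {Q : Type*}
    {rep : Q → K} (h : IsTransversal L M rep) (z : K) :
    ∃ P, HasProd (fun c => 1 - latExp L z / latExp L (rep c)) P ∧
      latExp M z = latExp L z * P := by
  classical
  have hL := hM.mono hLM
  by_cases hz : z ∈ L
  · exact ⟨1, by simp [latExp_of_mem hz, hasProd_one], by
      rw [latExp_of_mem hz, latExp_of_mem (hLM hz), zero_mul]⟩
  have hz0 : z ≠ 0 := fun h => hz (h ▸ L.zero_mem)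
  obtain ⟨c₀, hc₀, hc₀'⟩ := h.2 0 M.zero_mem
  have hmem : ∀ c, rep c ∈ L ↔ c = c₀ := fun c => by
    rw [← neg_mem_iff, ← zero_sub]
    exact ⟨fun h => hc₀' c h, fun h => h ▸ hc₀⟩
  have h1 := (hM.multipliable' z).hasProd
  rw [← (h.equiv hLM).hasProd_iff] at h1
  have h2 := h1.sigma (g := fun c => ∏' l : L, (1 - z / (rep c + l)))
    fun c => (hL.multipliable z (rep c)).hasProd
  set E := ∏' l : L, (1 - z / (l : K)) with hE
  have hE0 : E ≠ 0 := fun h0 => hz (hL.latExp_eq_zero.1 (by rw [latExp_eq_tprod, ← hE, h0, mul_zero]))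
  have h3 : ∏' l : L, (1 - z / (rep c₀ + l)) = E := by
    exact (Equiv.addLeft (⟨rep c₀, (hmem _).2 rfl⟩ : L)).tprod_eq
      (fun l : L => 1 - z / (l : K))
  -- The trivial class contributes `E` to the full product, whereas its factor in the claim is `1`;
  -- this auxiliary product moves `E` into the prefactor `e_L(z) = z E`.
  have h4 : HasProd (fun c => if c = c₀ then E⁻¹ else 1) E⁻¹ := by
    convert hasProd_single (f := fun c => if c = c₀ then E⁻¹ else 1) c₀ ?_ using 1
    · simp
    · exact fun c hc => if_neg hc
  refine ⟨_, (h2.mul h4).congr_fun fun c => ?_, ?_⟩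
  · split_ifs with hc
    · rw [hc, h3, latExp_of_mem ((hmem _).2 rfl), div_zero, sub_zero, mul_inv_cancel₀ hE0]
    · rw [mul_one, hL.tprod_coset fun h => hc ((hmem c).1 h)]
  · rw [latExp_eq_tprod, latExp_eq_tprod, ← hE]
    field_simp

end LatticeExponential

/-! ### Exponents of additive polynomials in characteristic `p` -/

section AdditivePolynomials

/-- By Lucas, removing a common factor `p` from both entries does not change the binomial modulo
`p`; after `i` steps it is `s`. -/
lemma not_dvd_choose_pow_mul {p : ℕ} (hp : p.Prime) (i : ℕ) {s : ℕ} (hs : ¬ p ∣ s) :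
    ¬ p ∣ (p ^ i * s).choose (p ^ i) := by
  have : Fact p.Prime := ⟨hp⟩
  induction i with
  | zero => simpa using hs
  | succ i ih =>
    have h := Choose.choose_modEq_choose_mod_mul_choose_div (n := p ^ (i + 1) * s)
      (k := p ^ (i + 1)) (p := p)
    have h1 : p ^ (i + 1) * s = p * (p ^ i * s) := by ring
    have h2 : p ^ (i + 1) = p * p ^ i := by ring
    rw [h1, h2, Nat.mul_mod_right, Nat.mul_mod_right, Nat.mul_div_cancel_left _ hp.pos,
      Nat.mul_div_cancel_left _ hp.pos, Nat.choose_self, Nat.cast_one, one_mul] at h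
    rw [h1, h2]
    intro hd
    refine ih ?_
    rw [← Int.natCast_dvd_natCast] at hd ⊢
    exact (Int.ModEq.dvd_iff h).1 hd

variable {K : Type*} [Field K]

/-- A polynomial that is additive on an infinite set only has terms of degree a power of the
characteristic. -/
theorem coeff_eq_zero_of_additive {p : ℕ} (hp : p.Prime) [CharP K p] {P : K[X]} {S : Set K}
    (hS : S.Infinite) (hadd : ∀ x ∈ S, ∀ y ∈ S, P.eval (x + y) = P.eval x + P.eval y) {n : ℕ}
    (hn : ∀ i, n ≠ p ^ i) : P.coeff n = 0 := by
  have h1 : ∀ y ∈ S, taylor y P = P + C (P.eval y) := fun y hy => by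
    refine eq_of_infinite_eval_eq _ _ (hS.mono fun x hx => ?_)
    rw [Set.mem_ofPred_eq, taylor_eval, eval_add, eval_C, hadd x hx y hy]
  -- Additivity says that translation by `y` changes only the constant term, so the `k`-th Taylor
  -- coefficient is the same at all `y ∈ S`.
  have h2 : ∀ k ≠ 0, hasseDeriv k P = C (P.coeff k) := fun k hk => by
    refine eq_of_infinite_eval_eq _ _ (hS.mono fun y hy => ?_)
    rw [Set.mem_ofPred_eq, ← taylor_coeff, h1 y hy, coeff_add, coeff_C_of_ne_zero hk, add_zero,
      eval_C]
  rcases Nat.eq_zero_or_pos n with rfl | hpos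
  · obtain ⟨y, hy⟩ := hS.nonempty
    have := congrArg (fun Q : K[X] => Q.coeff 0) (h1 y hy)
    simpa [taylor_coeff_zero] using this
  obtain ⟨i, s, hs, rfl⟩ := Nat.exists_eq_pow_mul_and_not_dvd hpos.ne' p hp.ne_one
  have hs1 : s ≠ 1 := fun h => hn i (by rw [h, mul_one])
  have hs0 : s ≠ 0 := fun h => hs (h ▸ dvd_zero p)
  obtain ⟨r, rfl⟩ : ∃ r, s = r + 2 := ⟨s - 2, by omega⟩
  have hpi : p ^ i ≠ 0 := (pow_pos hp.pos i).ne'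
  -- This coefficient of the constant polynomial `hasseDeriv (p ^ i) P` is the coefficient of `P` at
  -- `n = p ^ i * s`, times a binomial that is non-zero in `K`.
  have h3 := congrArg (fun Q : K[X] => Q.coeff (p ^ i * (r + 1))) (h2 (p ^ i) hpi)
  simp only [hasseDeriv_coeff] at h3
  rw [coeff_C_of_ne_zero (by positivity),
    show p ^ i * (r + 1) + p ^ i = p ^ i * (r + 2) by ring] at h3
  refine (mul_eq_zero.1 h3).resolve_left fun h => ?_
  exact not_dvd_choose_pow_mul hp i hs ((CharP.cast_eq_zero_iff K p _).1 h)

end AdditivePolynomials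

/-! ### The polynomials `φ_a` and their leading coefficients -/

section MultiplicationPolynomials

variable {K : Type*} [NormedField K] {L : AddSubgroup K}

/-- The group `a⁻¹ L`. -/
abbrev divSubgroup (L : AddSubgroup K) (a : K) : AddSubgroup K :=
  L.comap (AddMonoidHom.mulLeft a)

lemma mem_divSubgroup {a x : K} : x ∈ divSubgroup L a ↔ a * x ∈ L := Iff.rfl

/-- The polynomial describing the multiplication by `a` on the quotient by the lattice `L`. -/
def mulPoly (L : AddSubgroup K) (a : K) : K[X] :=
  C a * X *
    ∏ᶠ c : {c : divSubgroup L a ⧸ L.addSubgroupOf (divSubgroup L a) // c ≠ 0},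
      (1 - C (latExp L
        ((c : divSubgroup L a ⧸ L.addSubgroupOf (divSubgroup L a)).out : K))⁻¹ * X)

lemma divSubgroup_discrete (hL : StronglyDiscrete L) {a : K} (ha : a ≠ 0) :
    StronglyDiscrete (divSubgroup L a) := fun R => by
  refine ((hL (‖a‖ * R)).preimage (mul_right_injective₀ ha).injOn).subset fun x hx => ?_
  refine ⟨hx.1, ?_⟩
  rw [norm_mul]
  exact mul_le_mul_of_nonneg_left hx.2 (norm_nonneg a)

lemma latExp_divSubgroup {a : K} (ha : a ≠ 0) (z : K) :
    latExp L (a * z) = a * latExp (divSubgroup L a) z := by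
  let e : divSubgroup L a ≃ L :=
    { toFun := fun x => ⟨a * x, x.2⟩
      invFun := fun l => ⟨a⁻¹ * l, by
        rw [mem_divSubgroup, mul_inv_cancel_left₀ ha]; exact l.2⟩
      left_inv := fun x => Subtype.ext (inv_mul_cancel_left₀ ha _)
      right_inv := fun x => Subtype.ext (mul_inv_cancel_left₀ ha _) }
  rw [latExp_eq_tprod, latExp_eq_tprod,
    ← e.tprod_eq (fun l : L => 1 - a * z / (l : K)), mul_assoc]
  congr 2
  refine tprod_congr fun x => ?_
  change 1 - a * z / (a * (x : K)) = _
  rw [mul_div_mul_left _ _ ha]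

variable {Q : Type*} {rep : Q → K} {a : K}

lemma monic_prod_X_sub [Fintype Q] : (∏ c, (X - C (latExp L (rep c)))).Monic :=
  monic_prod_of_monic _ _ fun _ _ => monic_X_sub_C _

variable [IsUltrametricDist K] [CompleteSpace K]

lemma IsTransversal.latExp_ne_zero (hL : StronglyDiscrete L)
    (hr : IsTransversal L (divSubgroup L a) rep) {c₀ c : Q} (h0 : rep c₀ ∈ L) (hc : c ≠ c₀) :
    latExp L (rep c) ≠ 0 := fun h => by
  have h1 : ∀ c, rep c ∈ L → 0 - rep c ∈ L := fun c hc => by rwa [zero_sub, neg_mem_iff]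
  exact hc ((hr.2 0 (AddSubgroup.zero_mem _)).unique (h1 c (hL.latExp_eq_zero.1 h)) (h1 c₀ h0))

variable [Fintype Q]

/-- Periodicity of the exponential frees the product from the chosen representatives. The trivial
class may be included, since its factor is `1` with `0⁻¹ = 0`. -/
lemma mulPoly_eq (hL : StronglyDiscrete L) (hr : IsTransversal L (divSubgroup L a) rep) :
    mulPoly L a = C a * X * ∏ c, (1 - C (latExp L (rep c))⁻¹ * X) := by
  rw [mulPoly]
  congr 1
  set M := divSubgroup L a with hM
  set F : M ⧸ L.addSubgroupOf M → K[X] := fun c => 1 - C (latExp L (c.out : K))⁻¹ * X with hF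
  have hF0 : F 0 = 1 := by
    have : ((0 : M ⧸ L.addSubgroupOf M).out : K) ∈ L := by
      rw [← AddSubgroup.mem_addSubgroupOf]
      exact (QuotientAddGroup.eq_zero_iff _).1 (Quotient.out_eq' _)
    simp [hF, latExp_of_mem this]
  change ∏ᶠ c : {c : M ⧸ L.addSubgroupOf M // c ≠ 0}, F c = _
  have h1 : ∏ᶠ c : {c : M ⧸ L.addSubgroupOf M // c ≠ 0}, F c = ∏ᶠ c, F c := by
    rw [finprod_subtype_eq_finprod_cond (· ≠ 0) (f := F)]
    refine finprod_congr fun c => ?_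
    by_cases hc : c = 0
    · simp [hc, hF0]
    · simp [hc]
  rw [h1, ← finprod_eq_prod_of_fintype]
  symm
  refine finprod_eq_of_bijective (fun c => (QuotientAddGroup.mk ⟨rep c, hr.1 c⟩ :
    M ⧸ L.addSubgroupOf M)) ⟨fun c c' h => ?_, fun x => ?_⟩ fun c => ?_
  · rw [QuotientAddGroup.eq, AddSubgroup.mem_addSubgroupOf] at h
    refine (hr.2 (rep c') (hr.1 c')).unique ?_ (by simp)
    simpa [neg_add_eq_sub] using h
  · obtain ⟨x, rfl⟩ := QuotientAddGroup.mk_surjective x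
    obtain ⟨c, hc, -⟩ := hr.2 x x.2
    refine ⟨c, ?_⟩
    rw [QuotientAddGroup.eq, AddSubgroup.mem_addSubgroupOf]
    simpa [neg_add_eq_sub] using hc
  · have := Quotient.out_eq' (QuotientAddGroup.mk ⟨rep c, hr.1 c⟩ : M ⧸ L.addSubgroupOf M)
    have h2 := (QuotientAddGroup.eq (s := L.addSubgroupOf M)).1 this
    rw [AddSubgroup.mem_addSubgroupOf] at h2
    simp only [hF]
    rw [hL.latExp_eq_of_sub_mem (y := ((QuotientAddGroup.mk ⟨rep c, hr.1 c⟩ :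
      M ⧸ L.addSubgroupOf M).out : K))]
    simpa [neg_add_eq_sub] using h2

/-- Scaling gives `e_L(az) = a e_{a⁻¹L}(z)`, and the coset product for `L ≤ a⁻¹L` is finite and
polynomial in `e_L(z)`. -/
theorem eval_mulPoly (hL : StronglyDiscrete L) (ha : a ≠ 0) (hst : ∀ l ∈ L, a * l ∈ L)
    (hr : IsTransversal L (divSubgroup L a) rep) (z : K) :
    (mulPoly L a).eval (latExp L z) = latExp L (a * z) := by
  obtain ⟨P, hP, he⟩ := (divSubgroup_discrete hL ha).hasProd_latExp (L := L) hst hr z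
  rw [latExp_divSubgroup ha, he, mulPoly_eq hL hr, (hasProd_fintype _).unique hP |>.symm]
  simp only [eval_mul, eval_C, eval_X, eval_prod, eval_sub, eval_one]
  rw [mul_assoc]
  congr 2
  refine Finset.prod_congr rfl fun c _ => ?_
  rw [div_eq_mul_inv, mul_comm]

variable [DecidableEq Q] {c₀ : Q}

lemma mulPoly_eq_C_mul (hL : StronglyDiscrete L) (hr : IsTransversal L (divSubgroup L a) rep)
    (h0 : rep c₀ ∈ L) :
    mulPoly L a = C (a * ∏ c ∈ Finset.univ.erase c₀, (-(latExp L (rep c))⁻¹)) *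
      ∏ c, (X - C (latExp L (rep c))) := by
  rw [mulPoly_eq hL hr, ← Finset.mul_prod_erase _ _ (Finset.mem_univ c₀),
    ← Finset.mul_prod_erase _ (fun c => X - C (latExp L (rep c))) (Finset.mem_univ c₀),
    latExp_of_mem h0, inv_zero, C_0, zero_mul, sub_zero, one_mul, sub_zero, C_mul, map_prod,
    mul_assoc, mul_assoc, mul_left_comm (∏ c ∈ Finset.univ.erase c₀, C (-(latExp L (rep c))⁻¹)),
    ← Finset.prod_mul_distrib]
  congr 2
  refine Finset.prod_congr rfl fun c hc => ?_
  have hne := hr.latExp_ne_zero hL h0 (Finset.ne_of_mem_erase hc)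
  rw [mul_sub, ← C_mul, neg_mul, inv_mul_cancel₀ hne, C_neg, C_neg, C_1]
  ring

lemma leadingCoeff_mulPoly (hL : StronglyDiscrete L)
    (hr : IsTransversal L (divSubgroup L a) rep) (h0 : rep c₀ ∈ L) :
    (mulPoly L a).leadingCoeff = a * ∏ c ∈ Finset.univ.erase c₀, (-(latExp L (rep c))⁻¹) := by
  rw [mulPoly_eq_C_mul hL hr h0, leadingCoeff_mul, leadingCoeff_C,
    monic_prod_X_sub.leadingCoeff, mul_one]

/-- Evaluating at `-rep c` cancels the signs of the leading coefficient, so no parity of the number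
of classes enters later. -/
lemma leadingCoeff_mulPoly_mul (hL : StronglyDiscrete L)
    (hr : IsTransversal L (divSubgroup L a) rep) (h0 : rep c₀ ∈ L) :
    (mulPoly L a).leadingCoeff * ∏ c ∈ Finset.univ.erase c₀, latExp L (-rep c) = a := by
  rw [leadingCoeff_mulPoly hL hr h0, mul_assoc, ← Finset.prod_mul_distrib,
    Finset.prod_eq_one, mul_one]
  intro c hc
  rw [hL.latExp_neg, neg_mul_neg,
    inv_mul_cancel₀ (hr.latExp_ne_zero hL h0 (Finset.ne_of_mem_erase hc))]

lemma leadingCoeff_mulPoly_ne_zero (hL : StronglyDiscrete L) (ha : a ≠ 0)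
    (hr : IsTransversal L (divSubgroup L a) rep) (h0 : rep c₀ ∈ L) :
    (mulPoly L a).leadingCoeff ≠ 0 := fun h =>
  ha (by rw [← leadingCoeff_mulPoly_mul hL hr h0, h, zero_mul])

lemma natDegree_mulPoly (hL : StronglyDiscrete L) (ha : a ≠ 0)
    (hr : IsTransversal L (divSubgroup L a) rep) (h0 : rep c₀ ∈ L) :
    (mulPoly L a).natDegree = Fintype.card Q := by
  rw [mulPoly_eq_C_mul hL hr h0, natDegree_C_mul, natDegree_prod_of_monic]
  · simp
  · exact fun _ _ => monic_X_sub_C _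
  · rw [← leadingCoeff_mulPoly hL hr h0]
    exact leadingCoeff_mulPoly_ne_zero hL ha hr h0

lemma latExp_mul_eq_prod (hL : StronglyDiscrete L) (ha : a ≠ 0) (hst : ∀ l ∈ L, a * l ∈ L)
    (hr : IsTransversal L (divSubgroup L a) rep) (h0 : rep c₀ ∈ L) (z : K) :
    latExp L (a * z) = (mulPoly L a).leadingCoeff * ∏ c, latExp L (z - rep c) := by
  rw [← eval_mulPoly hL ha hst hr, leadingCoeff_mulPoly hL hr h0, mulPoly_eq_C_mul hL hr h0,
    eval_mul, eval_C, eval_prod]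
  congr 1
  refine Finset.prod_congr rfl fun c _ => ?_
  rw [eval_sub, eval_X, eval_C, hL.latExp_sub]

lemma StronglyDiscrete.exists_pos_lt_norm {K : Type*} [NormedField K] {L : AddSubgroup K}
    (hL : StronglyDiscrete L) : ∃ ε : ℝ, 0 < ε ∧ ∀ l ∈ L, l ≠ 0 → ε < ‖l‖ := by
  have h : ({x | x ∈ L ∧ ‖x‖ ≤ 1} \ {0}).Finite := (hL 1).sdiff
  obtain ⟨ε, hε, hb⟩ := Metric.isOpen_iff.1 h.isClosed.isOpen_compl 0 (by simp)
  refine ⟨min (ε / 2) (1 / 2), by positivity, fun l hl h0 => ?_⟩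
  by_contra hn
  rw [not_lt, le_min_iff] at hn
  refine hb (show l ∈ Metric.ball 0 ε from ?_) ⟨⟨hl, by linarith⟩, h0⟩
  rw [mem_ball_zero_iff]
  linarith

/-- Near `0` the exponential preserves norms, so high powers of `t⁻¹` have images of distinct norms.
This turns identities between values of `e` into polynomial identities. -/
lemma StronglyDiscrete.infinite_range_latExp {t : K} (ht : 1 < ‖t‖) (hL : StronglyDiscrete L) :
    (Set.range (latExp L)).Infinite := by
  obtain ⟨ε, hε, h⟩ := hL.exists_pos_lt_norm
  have ht0 : 0 < ‖t‖ := one_pos.trans ht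
  obtain ⟨N, hN⟩ := exists_pow_lt_of_lt_one hε (inv_lt_one_of_one_lt₀ ht)
  refine Set.infinite_of_injective_forall_mem (f := fun n : ℕ => latExp L (t⁻¹ ^ (n + N)))
    (fun m n hmn => ?_) fun n => ⟨_, rfl⟩
  have hlt : ∀ n : ℕ, ‖latExp L (t⁻¹ ^ (n + N))‖ = ‖t‖⁻¹ ^ (n + N) := fun n => by
    rw [hL.norm_latExp_of_lt, norm_pow, norm_inv]
    intro l hl h0
    refine lt_of_le_of_lt ?_ (h l hl h0)
    rw [norm_pow, norm_inv]
    exact (pow_le_pow_of_le_one (by positivity) (inv_le_one_of_one_le₀ ht.le)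
      (Nat.le_add_left N n)).trans hN.le
  have h' := congrArg norm hmn
  simp only [hlt] at h'
  have := (pow_right_strictAnti₀ (inv_pos.2 ht0) (inv_lt_one_of_one_lt₀ ht)).injective h'
  omega

end MultiplicationPolynomials

lemma finite_natDegree_le {R : Type*} [Semiring R] [Finite R] (N : ℕ) :
    {a : R[X] | a.natDegree ≤ N}.Finite := by
  have h : Finite (degreeLT R (N + 1)) := Finite.of_equiv _ (degreeLTEquiv R (N + 1)).symm.toEquiv
  refine (Set.toFinite (degreeLT R (N + 1) : Set R[X])).subset fun a ha => ?_
  rw [SetLike.mem_coe, mem_degreeLT]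
  exact degree_le_natDegree.trans_lt (by exact_mod_cast Nat.lt_succ_of_le ha)

/-! ### `A`-lattices with explicit bounds -/

section Lattices

variable {Fq : Type*} [Field Fq] [Fintype Fq] {K : Type*} [NormedField K]

/-- The norm of `K` restricts to the norm at infinity along `ι`. -/
def IsNormAtInfinity (ι : Fq[X] →+* K) : Prop :=
  ∀ a ≠ 0, ‖ι a‖ = (Fintype.card Fq : ℝ) ^ a.natDegree

/-- The lattice generated by the entries of `ω`. -/
def latticeOf (ι : Fq[X] →+* K) {n : ℕ} (ω : Fin n → K) : AddSubgroup K where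
  carrier := Set.range fun a : Fin n → Fq[X] => ∑ i, ι (a i) * ω i
  zero_mem' := ⟨0, by simp⟩
  add_mem' := by
    rintro _ _ ⟨a, rfl⟩ ⟨b, rfl⟩
    exact ⟨a + b, by simp [add_mul, Finset.sum_add_distrib]⟩
  neg_mem' := by
    rintro _ ⟨a, rfl⟩
    exact ⟨-a, by simp⟩

/-- The entries of `ω` generate a lattice, with explicit bounds: linear combinations are bounded
below by `δ` times their coefficients, and the entries are bounded by `B`. -/
structure IsLatticeBasis (ι : Fq[X] →+* K) {n : ℕ} (ω : Fin n → K) (δ B : ℝ) : Prop where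
  norm_coe : IsNormAtInfinity ι
  pos : 0 < δ
  lower : ∀ (a : Fin n → Fq[X]) (i : Fin n), δ * ‖ι (a i)‖ ≤ ‖∑ j, ι (a j) * ω j‖
  nonneg : 0 ≤ B
  upper : ∀ i, ‖ω i‖ ≤ B

variable {ι : Fq[X] →+* K} {n : ℕ} {ω : Fin n → K} {δ B : ℝ}

lemma one_lt_cardR : (1 : ℝ) < (Fintype.card Fq : ℝ) := one_lt_card Fq

lemma IsNormAtInfinity.one_le (h : IsNormAtInfinity ι) {a : Fq[X]} (ha : a ≠ 0) : 1 ≤ ‖ι a‖ := by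
  rw [h a ha]
  exact one_le_pow₀ one_lt_cardR.le

lemma IsNormAtInfinity.one_lt_X (h : IsNormAtInfinity ι) : 1 < ‖ι X‖ := by
  rw [h X X_ne_zero, natDegree_X, pow_one]
  exact one_lt_cardR

lemma IsNormAtInfinity.ne_zero (h : IsNormAtInfinity ι) {a : Fq[X]} (ha : a ≠ 0) : ι a ≠ 0 :=
  norm_pos_iff.1 (one_pos.trans_le (h.one_le ha))

lemma IsNormAtInfinity.injective (h : IsNormAtInfinity ι) : Function.Injective ι :=
  (injective_iff_map_eq_zero ι).2 fun a ha => by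
    by_contra h0
    exact h.ne_zero h0 ha

lemma IsNormAtInfinity.norm_le (h : IsNormAtInfinity ι) {a b : Fq[X]} (hab : a.degree < b.degree) :
    ‖ι a‖ ≤ ‖ι b‖ := by
  have hb : b ≠ 0 := fun h => by simp [h] at hab
  rcases eq_or_ne a 0 with rfl | ha
  · simp
  rw [h a ha, h b hb]
  exact pow_le_pow_right₀ one_lt_cardR.le (natDegree_le_natDegree hab.le)

lemma IsNormAtInfinity.finite (h : IsNormAtInfinity ι) (R : ℝ) : {a | ‖ι a‖ ≤ R}.Finite := by
  obtain ⟨N, hN⟩ := pow_unbounded_of_one_lt R (one_lt_cardR (Fq := Fq))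
  refine (finite_natDegree_le N).subset fun a ha => ?_
  rcases eq_or_ne a 0 with rfl | h0
  · simp
  rw [Set.mem_ofPred_eq, h a h0] at ha
  exact ((pow_lt_pow_iff_right₀ one_lt_cardR).1 (ha.trans_lt hN)).le

lemma IsNormAtInfinity.finite_pi (h : IsNormAtInfinity ι) (n : ℕ) (R : ℝ) :
    {a : Fin n → Fq[X] | ∀ i, ‖ι (a i)‖ ≤ R}.Finite := by
  refine (Set.Finite.pi' fun _ : Fin n => h.finite R).subset fun a ha => ?_
  exact ha

namespace IsLatticeBasis

lemma eq_zero (h : IsLatticeBasis ι ω δ B) {a : Fin n → Fq[X]} (ha : ∑ j, ι (a j) * ω j = 0) :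
    a = 0 := by
  funext i
  have := h.lower a i
  rw [ha, norm_zero] at this
  have h1 : ‖ι (a i)‖ ≤ 0 := le_of_mul_le_mul_left (by simpa using this) h.pos
  exact h.norm_coe.injective (by simpa using h1)

lemma injective (h : IsLatticeBasis ι ω δ B) :
    Function.Injective fun a : Fin n → Fq[X] => ∑ j, ι (a j) * ω j := fun a b hab => by
  rw [← sub_eq_zero]
  refine h.eq_zero ?_
  simp only [Pi.sub_apply, map_sub, sub_mul, Finset.sum_sub_distrib]
  exact sub_eq_zero.2 hab

lemma discrete (h : IsLatticeBasis ι ω δ B) : StronglyDiscrete (latticeOf ι ω) := fun R => by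
  refine ((h.norm_coe.finite_pi n (R / δ)).image fun a => ∑ j, ι (a j) * ω j).subset ?_
  rintro x ⟨⟨a, rfl⟩, hx⟩
  refine ⟨a, fun i => ?_, rfl⟩
  rw [le_div_iff₀ h.pos, mul_comm]
  exact (h.lower a i).trans hx

end IsLatticeBasis

lemma mul_mem_latticeOf (a : Fq[X]) {l : K} (hl : l ∈ latticeOf ι ω) :
    ι a * l ∈ latticeOf ι ω := by
  obtain ⟨b, rfl⟩ := hl
  exact ⟨fun i => a * b i, by simp [Finset.mul_sum, mul_assoc]⟩

/-- Representatives of the `t`-division points modulo the lattice. -/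
def divRep (ι : Fq[X] →+* K) (ω : Fin n → K) (b : Fin n → Fq) : K :=
  (ι X)⁻¹ * ∑ i, ι (C (b i)) * ω i

lemma IsLatticeBasis.isTransversal_divRep (h : IsLatticeBasis ι ω δ B) :
    IsTransversal (latticeOf ι ω) (divSubgroup (latticeOf ι ω) (ι X)) (divRep ι ω) := by
  have hX : ι X ≠ 0 := h.norm_coe.ne_zero X_ne_zero
  refine ⟨fun c => ?_, ?_⟩
  · rw [mem_divSubgroup, divRep, mul_inv_cancel_left₀ hX]
    exact ⟨fun i => C (c i), rfl⟩
  · rintro x ⟨a, ha⟩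
    have ha' : ∑ i, ι (a i) * ω i = ι X * x := ha
    have hx : x = (ι X)⁻¹ * ∑ i, ι (a i) * ω i := by rw [ha', inv_mul_cancel_left₀ hX]
    have key : ∀ c : Fin n → Fq, x - divRep ι ω c ∈ latticeOf ι ω ↔ c = fun i => (a i).coeff 0 := by
      intro c
      constructor
      · rintro ⟨b, hb⟩
        have hb' : ∑ i, ι (b i) * ω i = x - divRep ι ω c := hb
        have h1 : ∑ i, ι (X * b i) * ω i = ∑ i, ι (a i - C (c i)) * ω i := by
          simp only [map_mul, mul_assoc, ← Finset.mul_sum, hb', map_sub, sub_mul,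
            Finset.sum_sub_distrib]
          rw [hx, divRep, ← mul_sub, mul_inv_cancel_left₀ hX]
        funext i
        have h2 := congrArg (fun P => coeff P 0) (congrFun (h.injective h1) i)
        simp only [coeff_X_mul_zero, coeff_sub, coeff_C_zero] at h2
        exact (sub_eq_zero.1 h2.symm).symm
      · rintro rfl
        refine ⟨fun i => (a i).divX, ?_⟩
        change ∑ i, ι (a i).divX * ω i = _
        rw [hx, divRep, ← mul_sub, ← Finset.sum_sub_distrib, eq_inv_mul_iff_mul_eq₀ hX,
          Finset.mul_sum]
        refine Finset.sum_congr rfl fun i _ => ?_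
        rw [← sub_mul, ← map_sub, ← mul_assoc, ← map_mul]
        congr 2
        rw [eq_sub_iff_add_eq]
        exact X_mul_divX_add (a i)
    exact ⟨_, (key _).2 rfl, fun c hc => (key c).1 hc⟩

lemma divRep_zero : divRep ι ω 0 = 0 := by simp [divRep]

lemma divRep_zero_mem : divRep ι ω 0 ∈ latticeOf ι ω := by
  rw [divRep_zero]; exact AddSubgroup.zero_mem _

variable [IsUltrametricDist K]

lemma norm_sum_le_of_forall_le {κ : Type*} (s : Finset κ) (f : κ → K) {C : ℝ} (hC : 0 ≤ C)
    (h : ∀ i ∈ s, ‖f i‖ ≤ C) : ‖∑ i ∈ s, f i‖ ≤ C :=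
  IsUltrametricDist.norm_sum_le_of_forall_le_of_nonneg hC h

/-- Replace the coordinates of `a x` by their remainders modulo `a`; after division by `a` these
have norm at most `1`, so the bound does not involve `a`. -/
lemma IsLatticeBasis.exists_small_rep (h : IsLatticeBasis ι ω δ B) {a : Fq[X]} (ha : a ≠ 0) {x : K}
    (hx : x ∈ divSubgroup (latticeOf ι ω) (ι a)) :
    ∃ y ∈ divSubgroup (latticeOf ι ω) (ι a), x - y ∈ latticeOf ι ω ∧ ‖y‖ ≤ B := by
  have ha' : ι a ≠ 0 := h.norm_coe.ne_zero ha
  obtain ⟨b, hb⟩ := hx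
  have hb' : ∑ i, ι (b i) * ω i = ι a * x := hb
  refine ⟨(ι a)⁻¹ * ∑ i, ι (b i % a) * ω i, ?_, ⟨fun i => b i / a, ?_⟩, ?_⟩
  · rw [mem_divSubgroup, mul_inv_cancel_left₀ ha']
    exact ⟨_, rfl⟩
  · change ∑ i, ι (b i / a) * ω i = _
    rw [eq_sub_iff_add_eq, ← mul_right_inj' ha', mul_add, mul_inv_cancel_left₀ ha', ← hb',
      Finset.mul_sum, ← Finset.sum_add_distrib]
    refine Finset.sum_congr rfl fun i _ => ?_
    rw [← mul_assoc, ← map_mul, ← add_mul, ← map_add, EuclideanDomain.div_add_mod]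
  · rw [Finset.mul_sum]
    refine norm_sum_le_of_forall_le _ _ h.nonneg fun i _ => ?_
    rw [← mul_assoc, norm_mul, norm_mul, norm_inv]
    refine (mul_le_of_le_one_left (norm_nonneg _) ?_).trans (h.upper i)
    rw [inv_mul_le_one₀ (norm_pos_iff.2 ha')]
    exact h.norm_coe.norm_le (EuclideanDomain.mod_lt _ ha)

/-- The `a`-division points modulo the lattice have finitely many, bounded representatives. -/
theorem IsLatticeBasis.exists_transversal (h : IsLatticeBasis ι ω δ B) {a : Fq[X]} (ha : a ≠ 0) :
    ∃ (Q : Type) (_ : Fintype Q) (_ : DecidableEq Q) (rep : Q → K) (c₀ : Q),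
      IsTransversal (latticeOf ι ω) (divSubgroup (latticeOf ι ω) (ι a)) rep ∧
      rep c₀ ∈ latticeOf ι ω ∧ ∀ c, ‖rep c‖ ≤ B := by
  classical
  set L := latticeOf ι ω
  set M := divSubgroup L (ι a)
  have ha' : ι a ≠ 0 := h.norm_coe.ne_zero ha
  have hrep : ∀ c : M ⧸ L.addSubgroupOf M, ∃ y : M, QuotientAddGroup.mk y = c ∧ ‖(y : K)‖ ≤ B := by
    intro c
    obtain ⟨x, rfl⟩ := QuotientAddGroup.mk_surjective c
    obtain ⟨y, hy, hxy, hB⟩ := h.exists_small_rep ha x.2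
    refine ⟨⟨y, hy⟩, ?_, hB⟩
    rw [QuotientAddGroup.eq, AddSubgroup.mem_addSubgroupOf]
    simpa [neg_add_eq_sub] using hxy
  choose r hr hB using hrep
  have hrinj : Function.Injective r := fun c c' hcc => by rw [← hr c, ← hr c', hcc]
  have hfin : Finite (M ⧸ L.addSubgroupOf M) := by
    have : Finite {x | x ∈ M ∧ ‖x‖ ≤ B} := (divSubgroup_discrete h.discrete ha' B).to_subtype
    exact Finite.of_injective (fun c => (⟨r c, (r c).2, hB c⟩ : {x | x ∈ M ∧ ‖x‖ ≤ B}))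
      fun c c' hcc => hrinj (Subtype.ext (congrArg (fun z : {x | x ∈ M ∧ ‖x‖ ≤ B} => (z : K)) hcc))
  obtain ⟨N, ⟨e⟩⟩ := Finite.exists_equiv_fin (M ⧸ L.addSubgroupOf M)
  have htr : IsTransversal L M fun c : Fin N => (r (e.symm c) : K) := by
    refine ⟨fun c => (r _).2, fun x hx => ?_⟩
    have key : ∀ c, x - r (e.symm c) ∈ L ↔ c = e (QuotientAddGroup.mk ⟨x, hx⟩) := fun c => by
      rw [← e.symm_apply_eq, ← hr (e.symm c), QuotientAddGroup.eq, AddSubgroup.mem_addSubgroupOf,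
        hr]
      simp [neg_add_eq_sub]
    exact ⟨_, (key _).2 rfl, fun c hc => (key c).1 hc⟩
  obtain ⟨c₀, hc₀, -⟩ := htr.2 0 M.zero_mem
  refine ⟨Fin N, inferInstance, inferInstance, _, c₀, htr, ?_, fun c => hB _⟩
  simpa using hc₀

variable [CompleteSpace K]

/-- The exponential function on the division points is bounded in terms of `δ` and `B` only. -/
theorem exists_norm_latExp_le (ι : Fq[X] →+* K) (n : ℕ) (hι : IsNormAtInfinity ι) {δ B : ℝ}
    (hδ : 0 < δ) :
    ∃ M : ℝ, 1 ≤ M ∧ ∀ ω : Fin n → K, IsLatticeBasis ι ω δ B →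
      ∀ z : K, ‖z‖ ≤ B → ‖latExp (latticeOf ι ω) z‖ ≤ M := by
  -- Non-zero lattice vectors have norm at least `δ`, so each factor is at most `c`. Outside `T`
  -- some coordinate exceeds `B / δ`, the vector is longer than `B`, and the factor has norm `1`.
  -- Neither `c` nor `T` depends on `ω`.
  set c := max 1 (B / δ) with hc
  set T := (hι.finite_pi n (B / δ)).toFinset with hT
  refine ⟨max 1 B * c ^ T.card, one_le_mul_of_one_le_of_one_le (le_max_left _ _)
    (one_le_pow₀ (le_max_left _ _)), fun ω h z hz => ?_⟩
  let e : (Fin n → Fq[X]) ≃ latticeOf ι ω :=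
    Equiv.ofBijective (fun a => ⟨∑ j, ι (a j) * ω j, a, rfl⟩)
      ⟨fun a b hab => h.injective (congrArg Subtype.val hab),
        by rintro ⟨_, a, rfl⟩; exact ⟨a, rfl⟩⟩
  have hp := (h.discrete.multipliable' z).hasProd
  rw [latExp_eq_tprod, norm_mul]
  rw [← e.hasProd_iff] at hp
  refine mul_le_mul (hz.trans (le_max_right _ _)) (hasProd_norm_le_pow hp T (le_max_left _ _)
    (fun a _ => ?_) fun a ha => ?_) (norm_nonneg _) (by positivity)
  · change ‖1 - z / ∑ j, ι (a j) * ω j‖ ≤ c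
    rw [sub_eq_add_neg]
    refine (IsUltrametricDist.norm_add_le_max _ _).trans (max_le_max norm_one.le ?_)
    rw [norm_neg, norm_div]
    by_cases h0 : ∃ i, a i ≠ 0
    · obtain ⟨i, hi⟩ := h0
      refine div_le_div₀ h.nonneg hz hδ ((h.lower a i).trans' ?_)
      exact le_mul_of_one_le_right hδ.le (hι.one_le hi)
    · push Not at h0
      simp [h0, div_nonneg h.nonneg hδ.le]
  · refine (norm_eq_one_of_norm_sub_one_lt ?_).le
    change ‖1 - z / ∑ j, ι (a j) * ω j - 1‖ < 1
    simp only [hT, Set.Finite.mem_toFinset, Set.mem_ofPred_eq, not_forall, not_le] at ha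
    obtain ⟨i, hi⟩ := ha
    have h1 : B < ‖∑ j, ι (a j) * ω j‖ := by
      rw [div_lt_iff₀ hδ, mul_comm] at hi
      exact hi.trans_le (h.lower a i)
    rw [sub_sub_cancel_left, norm_neg, norm_div, div_lt_one (h.nonneg.trans_lt h1)]
    exact hz.trans_lt h1

end Lattices

/-! ### Reversal and coefficient bounds for products of polynomials -/

section Coefficients

lemma reflect_prod_X_sub_C {R κ : Type*} [CommRing R] (s : Finset κ) (v : κ → R) :
    (∏ i ∈ s, (X - C (v i))).reflect s.card = ∏ i ∈ s, (1 - C (v i) * X) := by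
  classical
  nontriviality R
  induction s using Finset.induction_on with
  | empty => simp
  | insert i s hi ih =>
    rw [Finset.prod_insert hi, Finset.prod_insert hi, Finset.card_insert_of_notMem hi, add_comm,
      reflect_mul _ _ (natDegree_X_sub_C_le _), ih, reflect_sub, reflect_one_X, reflect_C, pow_one]
    rw [natDegree_prod_of_monic _ _ fun _ _ => monic_X_sub_C _]
    simp

lemma norm_coeff_prod_le {κ : Type*} {K : Type*} [NormedField K] [IsUltrametricDist K]
    (s : Finset κ) (f : κ → K[X]) {M : ℝ} (hM : 0 ≤ M)
    (hf : ∀ i ∈ s, ∀ j, ‖(f i).coeff j‖ ≤ M ^ j) (j : ℕ) : ‖(∏ i ∈ s, f i).coeff j‖ ≤ M ^ j := by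
  classical
  induction s using Finset.induction_on generalizing j with
  | empty =>
    rw [Finset.prod_empty, coeff_one]
    split_ifs with h
    · simp [h]
    · simpa using pow_nonneg hM j
  | insert i s hi ih =>
    rw [Finset.prod_insert hi, coeff_mul]
    refine norm_sum_le_of_forall_le _ _ (pow_nonneg hM j) fun x hx => ?_
    rw [norm_mul, ← Finset.HasAntidiagonal.mem_antidiagonal.1 hx, pow_add]
    exact mul_le_mul (hf i (Finset.mem_insert_self _ _) _)
      (ih (fun k hk => hf k (Finset.mem_insert_of_mem hk)) _) (norm_nonneg _) (pow_nonneg hM _)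

end Coefficients

/-! ### The Drinfeld module of a lattice and the reversed polynomials -/

section DrinfeldModules

variable {Fq : Type*} [Field Fq] [Fintype Fq] {K : Type*} [NormedField K] [IsUltrametricDist K]
  [CompleteSpace K] {ι : Fq[X] →+* K} {n : ℕ} {ω : Fin n → K} {δ B : ℝ}

/-- The leading coefficient of `φ_a`. -/
def leadOf (ι : Fq[X] →+* K) (ω : Fin n → K) (a : Fq[X]) : K :=
  (mulPoly (latticeOf ι ω) (ι a)).leadingCoeff

namespace IsLatticeBasis

lemma eval_mulPoly (h : IsLatticeBasis ι ω δ B) {a : Fq[X]} (ha : a ≠ 0) (z : K) :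
    (mulPoly (latticeOf ι ω) (ι a)).eval (latExp (latticeOf ι ω) z) =
      latExp (latticeOf ι ω) (ι a * z) := by
  obtain ⟨Q, _, _, rep, c₀, hr, -, -⟩ := h.exists_transversal ha
  exact DrinfeldDisc.eval_mulPoly h.discrete (h.norm_coe.ne_zero ha)
    (fun l hl => mul_mem_latticeOf a hl) hr z

lemma leadOf_ne_zero (h : IsLatticeBasis ι ω δ B) {a : Fq[X]} (ha : a ≠ 0) :
    leadOf ι ω a ≠ 0 := by
  obtain ⟨Q, _, _, rep, c₀, hr, h0, -⟩ := h.exists_transversal ha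
  exact leadingCoeff_mulPoly_ne_zero h.discrete (h.norm_coe.ne_zero ha) hr h0

lemma infinite_range (h : IsLatticeBasis ι ω δ B) :
    (Set.range (latExp (latticeOf ι ω))).Infinite :=
  h.discrete.infinite_range_latExp h.norm_coe.one_lt_X

lemma mulPoly_C (h : IsLatticeBasis ι ω δ B) {c : Fq} (hc : c ≠ 0) :
    mulPoly (latticeOf ι ω) (ι (C c)) = C (ι (C c)) * X := by
  have hr : IsTransversal (latticeOf ι ω) (divSubgroup (latticeOf ι ω) (ι (C c)))
      (fun _ : Unit => (0 : K)) := by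
    refine ⟨fun _ => AddSubgroup.zero_mem _, fun x hx => ⟨(), ?_, fun _ _ => rfl⟩⟩
    have := mul_mem_latticeOf (C c⁻¹) hx
    rw [AddMonoidHom.coe_mulLeft, ← mul_assoc, ← map_mul, ← C_mul, inv_mul_cancel₀ hc] at this
    simpa using this
  rw [mulPoly_eq h.discrete hr]
  simp [latExp]

lemma latExp_C_mul (h : IsLatticeBasis ι ω δ B) (c : Fq) (z : K) :
    latExp (latticeOf ι ω) (ι (C c) * z) = ι (C c) * latExp (latticeOf ι ω) z := by
  rcases eq_or_ne c 0 with rfl | hc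
  · simp [latExp]
  · rw [← h.eval_mulPoly (C_ne_zero.2 hc), h.mulPoly_C hc, eval_mul, eval_C, eval_X]

lemma natDegree_mulPoly_X (h : IsLatticeBasis ι ω δ B) :
    (mulPoly (latticeOf ι ω) (ι X)).natDegree = Fintype.card Fq ^ n := by
  classical
  rw [natDegree_mulPoly h.discrete (h.norm_coe.ne_zero X_ne_zero) h.isTransversal_divRep
    divRep_zero_mem]
  simp

/-- Both sides agree on the infinitely many values of the exponential. This recursion yields degrees
and leading coefficients by induction on `deg a`. -/
lemma mulPoly_X_mul_add (h : IsLatticeBasis ι ω δ B) {a : Fq[X]} (ha : a ≠ 0) (c : Fq) :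
    mulPoly (latticeOf ι ω) (ι (X * a + C c)) =
      (mulPoly (latticeOf ι ω) (ι X)).comp (mulPoly (latticeOf ι ω) (ι a)) + C (ι (C c)) * X := by
  have h0 : X * a + C c ≠ 0 := fun h0 => by
    refine ha (Polynomial.ext fun k => ?_)
    simpa using congrArg (fun P : Fq[X] => P.coeff (k + 1)) h0
  refine eq_of_infinite_eval_eq _ _ (h.infinite_range.mono ?_)
  rintro _ ⟨z, rfl⟩
  rw [Set.mem_ofPred_eq, h.eval_mulPoly h0, eval_add, eval_comp, h.eval_mulPoly ha,
    h.eval_mulPoly X_ne_zero, eval_mul, eval_C, eval_X, ← h.latExp_C_mul, ← h.discrete.latExp_add,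
    map_add, map_mul]
  congr 1
  ring

lemma degree_C_mul_X_lt_degree_comp {a : Fq[X]} (hn : 1 ≤ n) (h : IsLatticeBasis ι ω δ B)
    (hd : (mulPoly (latticeOf ι ω) (ι a)).natDegree ≠ 0) (c : Fq) :
    (C (ι (C c)) * X : K[X]).degree <
      ((mulPoly (latticeOf ι ω) (ι X)).comp (mulPoly (latticeOf ι ω) (ι a))).degree := by
  have h2 : 1 < Fintype.card Fq ^ n := Nat.one_lt_pow (by omega) Fintype.one_lt_card
  have h1 : 1 < ((mulPoly (latticeOf ι ω) (ι X)).comp (mulPoly (latticeOf ι ω) (ι a))).natDegree := by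
    rw [natDegree_comp, h.natDegree_mulPoly_X]
    exact h2.trans_le (Nat.le_mul_of_pos_right _ (Nat.pos_of_ne_zero hd))
  refine (degree_C_mul_X_le _).trans_lt ?_
  rw [degree_eq_natDegree (fun h0 => by simp [h0] at h1)]
  exact_mod_cast h1

lemma natDegree_mulPoly (h : IsLatticeBasis ι ω δ B) (hn : 1 ≤ n) {a : Fq[X]} (ha : a ≠ 0) :
    (mulPoly (latticeOf ι ω) (ι a)).natDegree = Fintype.card Fq ^ (n * a.natDegree) := by
  induction hd : a.natDegree generalizing a with
  | zero =>
    obtain ⟨c, rfl⟩ := natDegree_eq_zero.1 hd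
    have hc : c ≠ 0 := by simpa using ha
    rw [h.mulPoly_C hc, natDegree_C_mul_X _ (h.norm_coe.ne_zero ha)]
    simp
  | succ d ih =>
    have hdiv : a.divX.natDegree = d := by rw [natDegree_divX_eq_natDegree_tsub_one, hd]; rfl
    have hdiv0 : a.divX ≠ 0 := fun h0 => by
      have := divX_eq_zero_iff.1 h0
      rw [this, natDegree_C] at hd
      omega
    have hih := ih hdiv0 hdiv
    have hne : (mulPoly (latticeOf ι ω) (ι a.divX)).natDegree ≠ 0 := by
      rw [hih]; exact (pow_pos Fintype.card_pos _).ne'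
    conv_lhs => rw [← X_mul_divX_add a]
    rw [h.mulPoly_X_mul_add hdiv0,
      natDegree_add_eq_left_of_degree_lt (degree_C_mul_X_lt_degree_comp hn h hne _), natDegree_comp,
      h.natDegree_mulPoly_X, hih, ← pow_add]
    congr 1
    ring

lemma leadOf_X_mul_add (h : IsLatticeBasis ι ω δ B) (hn : 1 ≤ n) {a : Fq[X]} (ha : a ≠ 0) (c : Fq) :
    leadOf ι ω (X * a + C c) = leadOf ι ω X * leadOf ι ω a ^ Fintype.card Fq ^ n := by
  have hne : (mulPoly (latticeOf ι ω) (ι a)).natDegree ≠ 0 := by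
    rw [h.natDegree_mulPoly hn ha]; exact (pow_pos Fintype.card_pos _).ne'
  rw [leadOf, h.mulPoly_X_mul_add ha, leadingCoeff_add_of_degree_lt' (degree_C_mul_X_lt_degree_comp hn h hne _),
    leadingCoeff_comp hne, h.natDegree_mulPoly_X]
  rfl

lemma leadOf_C (h : IsLatticeBasis ι ω δ B) {c : Fq} (hc : c ≠ 0) :
    leadOf ι ω (C c) = ι (C c) := by
  rw [leadOf, h.mulPoly_C hc, leadingCoeff_mul, leadingCoeff_C, leadingCoeff_X, mul_one]

end IsLatticeBasis

lemma mulPoly_C_mul {c : Fq} (hc : c ≠ 0) (a : Fq[X]) :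
    mulPoly (latticeOf ι ω) (ι (C c * a)) =
      C (ι (C c)) * mulPoly (latticeOf ι ω) (ι a) := by
  have hM : divSubgroup (latticeOf ι ω) (ι (C c * a)) = divSubgroup (latticeOf ι ω) (ι a) := by
    ext x
    rw [mem_divSubgroup, mem_divSubgroup, map_mul, mul_assoc]
    refine ⟨fun h => ?_, mul_mem_latticeOf _⟩
    have := mul_mem_latticeOf (C c⁻¹) h
    rw [← mul_assoc, ← map_mul, ← C_mul, inv_mul_cancel₀ hc] at this
    simpa using this
  rw [mulPoly, hM, mulPoly, map_mul, C_mul, mul_assoc, mul_assoc, mul_assoc]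

/-- The polynomial `Δ_a⁻¹ X ^ N φ_a(X⁻¹)`, where `N = q ^ (n deg a)`. -/
def reversedPoly (ι : Fq[X] →+* K) (ω : Fin n → K) (a : Fq[X]) : K[X] :=
  C (leadOf ι ω a)⁻¹ *
    (mulPoly (latticeOf ι ω) (ι a)).reflect (Fintype.card Fq ^ (n * a.natDegree))

lemma reversedPoly_C_mul (hι : IsNormAtInfinity ι) {c : Fq} (hc : c ≠ 0) (a : Fq[X]) :
    reversedPoly ι ω (C c * a) = reversedPoly ι ω a := by
  have hc' : ι (C c) ≠ 0 := hι.ne_zero (C_ne_zero.2 hc)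
  rw [reversedPoly, leadOf, mulPoly_C_mul hc, natDegree_C_mul hc, reflect_C_mul, leadingCoeff_mul,
    leadingCoeff_C, mul_inv, mul_comm (ι (C c))⁻¹, C_mul, mul_assoc, ← mul_assoc (C (ι (C c))⁻¹),
    ← C_mul (a := (ι (C c))⁻¹), inv_mul_cancel₀ hc', C_1, one_mul]
  rfl

namespace IsLatticeBasis

lemma eval_reversedPoly (h : IsLatticeBasis ι ω δ B) (hn : 1 ≤ n) {a : Fq[X]} (ha : a ≠ 0) {z : K}
    (hz : z ∉ latticeOf ι ω) :
    (reversedPoly ι ω a).eval (latExp (latticeOf ι ω) z)⁻¹ =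
      (leadOf ι ω a)⁻¹ * (latExp (latticeOf ι ω) z)⁻¹ ^ (Fintype.card Fq ^ (n * a.natDegree)) *
        latExp (latticeOf ι ω) (ι a * z) := by
  have hz0 : latExp (latticeOf ι ω) z ≠ 0 := fun h0 => hz (h.discrete.latExp_eq_zero.1 h0)
  have : Invertible (latExp (latticeOf ι ω) z) := invertibleOfNonzero hz0
  have key := eval₂_reflect_mul_pow (RingHom.id K) (latExp (latticeOf ι ω) z)
    (Fintype.card Fq ^ (n * a.natDegree)) (mulPoly (latticeOf ι ω) (ι a))
    (h.natDegree_mulPoly hn ha).le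
  rw [invOf_eq_inv, eval₂_id, eval₂_id, h.eval_mulPoly ha] at key
  rw [reversedPoly, eval_mul, eval_C, ← key, inv_pow, mul_assoc, mul_comm (eval _ _),
    inv_mul_cancel_left₀ (pow_ne_zero _ hz0)]

lemma coeff_reversedPoly_zero (h : IsLatticeBasis ι ω δ B) (hn : 1 ≤ n) {a : Fq[X]} (ha : a ≠ 0) :
    (reversedPoly ι ω a).coeff 0 = 1 := by
  rw [reversedPoly, coeff_C_mul, coeff_reflect, revAt_zero, ← h.natDegree_mulPoly hn ha]
  exact inv_mul_cancel₀ (h.leadOf_ne_zero ha)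

lemma coeff_reversedPoly_eq_zero (h : IsLatticeBasis ι ω δ B) {a : Fq[X]} (ha : a ≠ 0)
    {j : ℕ} (hj : j ≠ 0) (hj' : 2 * j < Fintype.card Fq ^ (n * a.natDegree)) :
    (reversedPoly ι ω a).coeff j = 0 := by
  set N := Fintype.card Fq ^ (n * a.natDegree) with hN
  obtain ⟨p, hp⟩ := CharP.exists Fq
  obtain ⟨e, hpp, he⟩ := FiniteField.card Fq p
  have hcK : CharP K p :=
    charP_of_injective_ringHom (f := ι.comp (C : Fq →+* Fq[X])) 
      (h.norm_coe.injective.comp C_injective) p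
  rw [reversedPoly, coeff_C_mul, coeff_reflect, ← hN, revAt_le (by omega),
    -- Reversal moves index `j` to `N - j`, strictly between `N / 2` and `N`. As `N` is a power of
    -- `p`, no power of `p` lies there.
    coeff_eq_zero_of_additive hpp h.infinite_range, mul_zero]
  · rintro _ ⟨x, rfl⟩ _ ⟨y, rfl⟩
    rw [← h.discrete.latExp_add, h.eval_mulPoly ha, h.eval_mulPoly ha, h.eval_mulPoly ha, mul_add,
      h.discrete.latExp_add]
  · intro i hi
    have hN' : N = p ^ (e * (n * a.natDegree)) := by rw [hN, he, ← pow_mul]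
    have h1 : p ^ i < p ^ (e * (n * a.natDegree)) := by rw [← hi, ← hN']; omega
    have h2 : i < e * (n * a.natDegree) := (Nat.pow_lt_pow_iff_right hpp.one_lt).1 h1
    have h3 : p ^ (i + 1) ≤ N := by rw [hN']; exact Nat.pow_le_pow_right hpp.pos h2
    have h4 : 2 * p ^ i ≤ p ^ (i + 1) := by
      rw [pow_succ, mul_comm]; exact Nat.mul_le_mul_left _ hpp.two_le
    omega

/-- The reversed polynomial is `∏ (1 - e(λ) X)` over representatives `λ` of norm at most `B`, and
the bound `M ^ j` is stable under products. -/
lemma norm_coeff_reversedPoly_le (h : IsLatticeBasis ι ω δ B) (hn : 1 ≤ n) {a : Fq[X]} (ha : a ≠ 0)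
    {M : ℝ} (hM : 0 ≤ M) (hb : ∀ z : K, ‖z‖ ≤ B → ‖latExp (latticeOf ι ω) z‖ ≤ M) (j : ℕ) :
    ‖(reversedPoly ι ω a).coeff j‖ ≤ M ^ j := by
  obtain ⟨Q, _, _, rep, c₀, hr, h0, hB⟩ := h.exists_transversal ha
  have hcard := DrinfeldDisc.natDegree_mulPoly h.discrete (h.norm_coe.ne_zero ha) hr h0
  rw [h.natDegree_mulPoly hn ha] at hcard
  have hl := h.leadOf_ne_zero ha
  have key : reversedPoly ι ω a = ∏ c, (1 - C (latExp (latticeOf ι ω) (rep c)) * X) := by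
    rw [reversedPoly, mulPoly_eq_C_mul h.discrete hr h0, ← leadingCoeff_mulPoly h.discrete hr h0,
      reflect_C_mul, ← mul_assoc, ← C_mul]
    change C ((leadOf ι ω a)⁻¹ * leadOf ι ω a) * _ = _
    rw [inv_mul_cancel₀ hl, C_1, one_mul, hcard]
    exact reflect_prod_X_sub_C _ _
  rw [key]
  refine norm_coeff_prod_le _ _ hM (fun c _ j => ?_) j
  rcases j with _ | _ | j
  · simp
  · simpa [coeff_one] using hb _ (hB c)
  · simpa [coeff_one, coeff_X] using pow_nonneg hM (j + 2)

end IsLatticeBasis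

end DrinfeldModules

/-! ### Reindexing products over `A` -/

section ProductReindexing

variable {Fq : Type*} [Field Fq] [Fintype Fq] {K : Type*} [NormedField K] {g : Fq[X] → K} {P : K}

/-- Division by `t` with remainder is a bijection from `A` to `A × Fq`. -/
lemma hasProd_X_mul_add (hP : HasProd g P) : HasProd (fun a => ∏ b, g (X * a + C b)) P := by
  let e : (Σ _ : Fq[X], Fq) ≃ Fq[X] :=
    { toFun := fun x => X * x.1 + C x.2
      invFun := fun a => ⟨a.divX, a.coeff 0⟩
      left_inv := fun x => by
        have h1 : (X * x.1 + C x.2).divX = x.1 := by ext; simp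
        have h2 : (X * x.1 + C x.2).coeff 0 = x.2 := by simp
        exact Sigma.ext h1 (heq_of_eq h2)
      right_inv := fun a => X_mul_divX_add a }
  rw [← e.hasProd_iff] at hP
  exact hP.sigma fun a => hasProd_fintype _

lemma hasProd_monic (hP : HasProd g P) (h0 : g 0 = 1)
    (hc : ∀ a : Fq[X], ∀ c : Fq, c ≠ 0 → g (C c * a) = g a) :
    HasProd (fun a : {a : Fq[X] // a.Monic} => g a ^ (Fintype.card Fq - 1)) P := by
  classical
  let j : (Σ _ : {a : Fq[X] // a.Monic}, Fqˣ) → Fq[X] := fun x => C (x.2 : Fq) * x.1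
  have hlead : ∀ x, (j x).leadingCoeff = x.2 := fun x => by
    simp only [j]
    rw [leadingCoeff_mul, leadingCoeff_C, x.1.2.leadingCoeff, mul_one]
  have hj : Function.Injective j := by
    rintro ⟨a, c⟩ ⟨b, d⟩ h
    have hcd : c = d := Units.ext (by rw [← hlead ⟨a, c⟩, h, hlead])
    subst hcd
    have : a = b := Subtype.ext (mul_left_cancel₀ (C_ne_zero.2 c.ne_zero) h)
    rw [this]
  rw [← hj.hasProd_iff] at hP
  · convert hP.sigma fun a => hasProd_fintype _ using 2 with a
    simp only [Function.comp, j]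
    rw [Finset.prod_congr rfl fun (c : Fqˣ) _ => hc a c c.ne_zero, Finset.prod_const,
      Finset.card_univ, Fintype.card_units]
  · intro a ha
    rcases eq_or_ne a 0 with rfl | ha0
    · exact h0
    · have hl : a.leadingCoeff ≠ 0 := leadingCoeff_ne_zero.2 ha0
      refine absurd ⟨⟨⟨C a.leadingCoeff⁻¹ * a, ?_⟩, Units.mk0 _ hl⟩, ?_⟩ ha
      · rw [mul_comm]; exact monic_mul_leadingCoeff_inv ha0
      · change C a.leadingCoeff * (C a.leadingCoeff⁻¹ * a) = a
        rw [← mul_assoc, ← C_mul, mul_inv_cancel₀ hl, C_1, one_mul]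

end ProductReindexing

/-! ### The product formula for a fixed `ω` -/

section ProductFormula

variable {Fq : Type*} [Field Fq] [Fintype Fq] {K : Type*} [NormedField K]
  {ι : Fq[X] →+* K} {m : ℕ} {ω : Fin (m + 1) → K} {δ B δ' B' : ℝ}

lemma latticeOf_tail_le : latticeOf ι (Fin.tail ω) ≤ latticeOf ι ω := by
  rintro _ ⟨a, rfl⟩
  exact ⟨Fin.cons 0 a, by simp [Fin.sum_univ_succ, Fin.tail]⟩

lemma IsLatticeBasis.isTransversal_tail (h : IsLatticeBasis ι ω δ B) :
    IsTransversal (latticeOf ι (Fin.tail ω)) (latticeOf ι ω) fun a => ι a * ω 0 := by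
  refine ⟨fun a => ⟨Fin.cons a 0, by simp [Fin.sum_univ_succ]⟩, ?_⟩
  rintro _ ⟨a, rfl⟩
  refine ⟨a 0, ⟨Fin.tail a, ?_⟩, fun c hc => ?_⟩
  · simp [Fin.sum_univ_succ, Fin.tail]
  · obtain ⟨b, hb⟩ := hc
    have h1 := h.injective (a₁ := Fin.cons c b) (a₂ := a) (by
      have hb' : ∑ i, ι (b i) * Fin.tail ω i = ∑ i, ι (a i) * ω i - ι c * ω 0 := hb
      simp only [Fin.sum_univ_succ (n := m) (fun i => ι ((Fin.cons c b : Fin (m + 1) → Fq[X]) i) * ω i),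
        Fin.cons_zero, Fin.cons_succ]
      change _ + ∑ i, ι (b i) * Fin.tail ω i = _
      rw [hb']; ring)
    rw [← h1, Fin.cons_zero]

lemma IsLatticeBasis.mul_notMem_tail (h : IsLatticeBasis ι ω δ B) {a : Fq[X]} (ha : a ≠ 0) :
    ι a * ω 0 ∉ latticeOf ι (Fin.tail ω) := fun hmem => by
  refine ha ((h.isTransversal_tail.2 0 (AddSubgroup.zero_mem _)).unique ?_ ?_)
  · simpa using hmem
  · simp

lemma divRep_cons (b : Fq) (x : Fin m → Fq) :
    divRep ι ω (Fin.cons b x) = (ι X)⁻¹ * (ι (C b) * ω 0) + divRep ι (Fin.tail ω) x := by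
  simp only [divRep, Fin.sum_univ_succ, Fin.cons_zero, Fin.cons_succ, mul_add]
  rfl

/-- Wilson's theorem in `Fq`; the signs are absorbed by the permutation `b ↦ -b`. It is the source
of the minus sign in the formula. -/
lemma prod_ne_zero_eq_neg_one [DecidableEq Fq] (ι : Fq[X] →+* K) :
    ∏ b ∈ Finset.univ.erase (0 : Fq), -ι (C b) = -1 := by
  have h1 : ∏ b ∈ Finset.univ.erase (0 : Fq), -b = -1 := by
    have h0 := congrArg Units.val (FiniteField.prod_univ_units_id_eq_neg_one (K := Fq))
    rw [Units.coe_prod, Units.val_neg, Units.val_one] at h0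
    rw [← h0]
    symm
    refine Finset.prod_bij (fun c _ => -(c : Fq)) ?_ ?_ ?_ ?_
    · intro c _; simp
    · intro c _ d _ hcd; exact Units.ext (neg_injective hcd)
    · intro b hb
      exact ⟨Units.mk0 (-b) (neg_ne_zero.2 (Finset.ne_of_mem_erase hb)), Finset.mem_univ _, by simp⟩
    · intro c _; simp
  have h2 := congrArg (ι.comp C) h1
  simpa [map_prod] using h2

/-- The values of the reversed polynomials at the parameter, with value `1` at `a = 0`. -/
def paramValue (ι : Fq[X] →+* K) (ω : Fin (m + 1) → K) (a : Fq[X]) : K :=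
  open Classical in
  if a = 0 then 1 else
    (reversedPoly ι (Fin.tail ω) a).eval (latExp (latticeOf ι (Fin.tail ω)) (ω 0))⁻¹

lemma paramValue_zero : paramValue ι ω 0 = 1 := if_pos rfl

variable [IsUltrametricDist K] [CompleteSpace K]

lemma leadOf_mul_prod (h' : IsLatticeBasis ι (Fin.tail ω) δ' B') (y : K) :
    leadOf ι (Fin.tail ω) X * ∏ x, latExp (latticeOf ι (Fin.tail ω)) (y - divRep ι (Fin.tail ω) x) =
      latExp (latticeOf ι (Fin.tail ω)) (ι X * y) := by
  classical
  exact (latExp_mul_eq_prod h'.discrete (h'.norm_coe.ne_zero X_ne_zero)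
    (fun l hl => mul_mem_latticeOf X hl) h'.isTransversal_divRep divRep_zero_mem y).symm

/-- The product of the values of the exponential of the smaller lattice at the non-trivial
`t`-division points of the larger one. -/
lemma leadOf_pow_mul_prod_latExp [DecidableEq (Fin (m + 1) → Fq)]
    (h' : IsLatticeBasis ι (Fin.tail ω) δ' B') :
    leadOf ι (Fin.tail ω) X ^ Fintype.card Fq *
        ∏ c ∈ Finset.univ.erase (0 : Fin (m + 1) → Fq),
          latExp (latticeOf ι (Fin.tail ω)) (-divRep ι ω c) =
      -(ι X * latExp (latticeOf ι (Fin.tail ω)) (ω 0) ^ (Fintype.card Fq - 1)) := by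
  classical
  set e := latExp (latticeOf ι (Fin.tail ω)) with he
  set D := leadOf ι (Fin.tail ω) X with hD
  have hX : ι X ≠ 0 := h'.norm_coe.ne_zero X_ne_zero
  -- The value `1` at `c = 0` lets the product range over all `c`, so that it splits by the first
  -- coordinate.
  set H : (Fin (m + 1) → Fq) → K := fun c => if c = 0 then 1 else e (-divRep ι ω c) with hH
  have h1 : ∏ c ∈ Finset.univ.erase (0 : Fin (m + 1) → Fq), e (-divRep ι ω c) = ∏ c, H c := by
    rw [← Finset.mul_prod_erase _ H (Finset.mem_univ 0)]
    simp only [hH, if_true, one_mul]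
    exact Finset.prod_congr rfl fun c hc => (if_neg (Finset.ne_of_mem_erase hc)).symm
  have h2 : ∏ c, H c = ∏ b, ∏ x : Fin m → Fq, H (Fin.cons b x) := by
    rw [← (Fin.consEquiv fun _ => Fq).prod_comp, Fintype.prod_prod_type]
    rfl
  -- The block `b = 0` consists of the `t`-division points of the smaller lattice alone.
  have h3 : D * ∏ x : Fin m → Fq, H (Fin.cons 0 x) = ι X := by
    rw [← leadingCoeff_mulPoly_mul h'.discrete h'.isTransversal_divRep divRep_zero_mem,
      ← Finset.mul_prod_erase _ (fun x : Fin m → Fq => H (Fin.cons 0 x)) (Finset.mem_univ 0)]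
    have : H (Fin.cons 0 0) = 1 := if_pos (by ext i; refine Fin.cases rfl (fun _ => rfl) i)
    rw [this, one_mul]
    refine congrArg _ (Finset.prod_congr rfl fun x hx => ?_)
    have hne : (Fin.cons 0 x : Fin (m + 1) → Fq) ≠ 0 := fun h0 =>
      Finset.ne_of_mem_erase hx (funext fun i => congrFun h0 i.succ)
    simp only [hH, if_neg hne]
    rw [divRep_cons]
    simp [he]
  -- The block of `b ≠ 0` is the factorization of `e(t y)` at `y = -b ω_1 / t`.
  have h4 : ∀ b ∈ Finset.univ.erase (0 : Fq),
      D * ∏ x : Fin m → Fq, H (Fin.cons b x) = -ι (C b) * e (ω 0) := fun b hb => by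
    have hb0 := Finset.ne_of_mem_erase hb
    have h5 := leadOf_mul_prod h' (-((ι X)⁻¹ * (ι (C b) * ω 0)))
    rw [mul_neg, mul_inv_cancel_left₀ hX, h'.discrete.latExp_neg, h'.latExp_C_mul,
      ← neg_mul (ι (C b)) (latExp _ _)] at h5
    rw [← h5]
    refine congrArg _ (Finset.prod_congr rfl fun x _ => ?_)
    have hne : (Fin.cons b x : Fin (m + 1) → Fq) ≠ 0 := fun h0 => hb0 (congrFun h0 0)
    simp only [hH, if_neg hne]
    rw [divRep_cons, neg_add']
  have h6 : D ^ Fintype.card Fq * ∏ b, ∏ x : Fin m → Fq, H (Fin.cons b x) =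
      ∏ b, (D * ∏ x : Fin m → Fq, H (Fin.cons b x)) := by
    rw [Finset.prod_mul_distrib, Finset.prod_const, Finset.card_univ]
  rw [h1, h2, h6, ← Finset.mul_prod_erase _ _ (Finset.mem_univ (0 : Fq)), h3,
    Finset.prod_congr rfl h4, Finset.prod_mul_distrib, prod_ne_zero_eq_neg_one, Finset.prod_const,
    Finset.card_erase_of_mem (Finset.mem_univ _), Finset.card_univ]
  ring

lemma IsLatticeBasis.latExp_ne_zero (h : IsLatticeBasis ι ω δ B)
    (h' : IsLatticeBasis ι (Fin.tail ω) δ' B') {a : Fq[X]} (ha : a ≠ 0) :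
    latExp (latticeOf ι (Fin.tail ω)) (ι a * ω 0) ≠ 0 := fun h0 =>
  h.mul_notMem_tail ha (h'.discrete.latExp_eq_zero.1 h0)

lemma paramValue_of_ne_zero (h : IsLatticeBasis ι ω δ B) (h' : IsLatticeBasis ι (Fin.tail ω) δ' B')
    (hm : 1 ≤ m) {a : Fq[X]} (ha : a ≠ 0) :
    paramValue ι ω a = (leadOf ι (Fin.tail ω) a)⁻¹ *
      (latExp (latticeOf ι (Fin.tail ω)) (ω 0))⁻¹ ^ (Fintype.card Fq ^ (m * a.natDegree)) *
        latExp (latticeOf ι (Fin.tail ω)) (ι a * ω 0) := by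
  rw [paramValue, if_neg ha, h'.eval_reversedPoly hm ha]
  simpa using h.mul_notMem_tail one_ne_zero

lemma paramValue_ne_zero (h : IsLatticeBasis ι ω δ B) (h' : IsLatticeBasis ι (Fin.tail ω) δ' B')
    (hm : 1 ≤ m) (a : Fq[X]) : paramValue ι ω a ≠ 0 := by
  rcases eq_or_ne a 0 with rfl | ha
  · rw [paramValue_zero]; exact one_ne_zero
  · rw [paramValue_of_ne_zero h h' hm ha]
    have h1 := h.latExp_ne_zero h' one_ne_zero
    rw [map_one, one_mul] at h1
    exact mul_ne_zero (mul_ne_zero (inv_ne_zero (h'.leadOf_ne_zero ha))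
      (pow_ne_zero _ (inv_ne_zero h1))) (h.latExp_ne_zero h' ha)

lemma paramValue_C_mul (hι : IsNormAtInfinity ι) {c : Fq} (hc : c ≠ 0) (a : Fq[X]) :
    paramValue ι ω (C c * a) = paramValue ι ω a := by
  rcases eq_or_ne a 0 with rfl | ha
  · rw [mul_zero]
  · rw [paramValue, paramValue, if_neg ha, if_neg (mul_ne_zero (C_ne_zero.2 hc) ha),
      reversedPoly_C_mul hι hc]

lemma paramValue_C (h : IsLatticeBasis ι ω δ B) (h' : IsLatticeBasis ι (Fin.tail ω) δ' B')
    (hm : 1 ≤ m) (c : Fq) : paramValue ι ω (C c) = 1 := by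
  rcases eq_or_ne c 0 with rfl | hc
  · rw [C_0, paramValue_zero]
  · have h1 := h.latExp_ne_zero h' one_ne_zero
    have h2 : ι (C c) ≠ 0 := h.norm_coe.ne_zero (C_ne_zero.2 hc)
    rw [map_one, one_mul] at h1
    rw [paramValue_of_ne_zero h h' hm (C_ne_zero.2 hc), h'.leadOf_C hc, h'.latExp_C_mul, natDegree_C,
      mul_zero, pow_zero, pow_one]
    field_simp

/-- By additivity the factor of `c` is `e(a ω_1 - λ_c) / e(a ω_1)`. For fixed first coordinate `b`
the numerators multiply to `e((ta - b) ω_1) / D`, and the normalizing factors match since `Δ'_{ta-b}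
= D Δ'_a^{q^m}`. At `a = 0` both sides are `1`, by `x / 0 = 0` and the value `1` of `paramValue` at
constants. -/
lemma prod_coset_factor (h : IsLatticeBasis ι ω δ B) (h' : IsLatticeBasis ι (Fin.tail ω) δ' B')
    (hm : 1 ≤ m) (a : Fq[X]) :
    (∏ c : Fin (m + 1) → Fq, (1 + latExp (latticeOf ι (Fin.tail ω)) (-divRep ι ω c) /
        latExp (latticeOf ι (Fin.tail ω)) (ι a * ω 0))) * paramValue ι ω a ^ Fintype.card Fq ^ (m + 1)
      = ∏ b, paramValue ι ω (X * a + C b) := by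
  classical
  rcases eq_or_ne a 0 with rfl | ha
  · simp [paramValue_zero, paramValue_C h h' hm, latExp]
  set e := latExp (latticeOf ι (Fin.tail ω)) with he
  set D := leadOf ι (Fin.tail ω) X with hD
  have hX : ι X ≠ 0 := h'.norm_coe.ne_zero X_ne_zero
  have hea : e (ι a * ω 0) ≠ 0 := h.latExp_ne_zero h' ha
  have hD0 : D ≠ 0 := h'.leadOf_ne_zero X_ne_zero
  have hl0 := h'.leadOf_ne_zero ha
  have he1 : e (ω 0) ≠ 0 := by simpa using h.latExp_ne_zero h' (one_ne_zero (α := Fq[X]))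
  have h1 : ∀ b : Fq, ∏ x : Fin m → Fq, (1 + e (-divRep ι ω (Fin.cons b x)) / e (ι a * ω 0)) *
      paramValue ι ω a = paramValue ι ω (X * a + C (-b)) := fun b => by
    have hne : X * a + C (-b) ≠ 0 := fun h0 => by
      refine ha (Polynomial.ext fun k => ?_)
      simpa using congrArg (fun P : Fq[X] => P.coeff (k + 1)) h0
    have hdeg : (X * a + C (-b)).natDegree = a.natDegree + 1 := by
      rw [natDegree_add_C, natDegree_X_mul ha]
    have h2 := leadOf_mul_prod h' (ι a * ω 0 - (ι X)⁻¹ * (ι (C b) * ω 0))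
    have h3 : ι X * (ι a * ω 0 - (ι X)⁻¹ * (ι (C b) * ω 0)) = ι (X * a + C (-b)) * ω 0 := by
      rw [mul_sub, mul_inv_cancel_left₀ hX, map_add, map_mul, C_neg, map_neg]
      ring
    rw [h3] at h2
    have h4 : ∀ x : Fin m → Fq, (1 + e (-divRep ι ω (Fin.cons b x)) / e (ι a * ω 0)) *
        paramValue ι ω a =
        e (ι a * ω 0 - (ι X)⁻¹ * (ι (C b) * ω 0) - divRep ι (Fin.tail ω) x) *
          (paramValue ι ω a / e (ι a * ω 0)) := fun x => by
      rw [show ι a * ω 0 - (ι X)⁻¹ * (ι (C b) * ω 0) - divRep ι (Fin.tail ω) x =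
        ι a * ω 0 + -divRep ι ω (Fin.cons b x) by rw [divRep_cons]; ring, he,
        h'.discrete.latExp_add]
      rw [← he]
      field_simp
    rw [Finset.prod_congr rfl fun x _ => h4 x, Finset.prod_mul_distrib, Finset.prod_const,
      Finset.card_univ, Fintype.card_fun, Fintype.card_fin,
      paramValue_of_ne_zero h h' hm hne, paramValue_of_ne_zero h h' hm ha,
      h'.leadOf_X_mul_add hm ha, hdeg, ← h2, ← he, ← hD, mul_div_assoc, div_self hea, mul_one,
      mul_pow, ← pow_mul, ← pow_add, show m * a.natDegree + m = m * (a.natDegree + 1) by ring, inv_pow, inv_pow]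
    field_simp
  rw [← Equiv.prod_comp (Equiv.neg Fq) fun b => paramValue ι ω (X * a + C b),
    ← (Fin.consEquiv fun _ => Fq).prod_comp
      (fun c => 1 + e (-divRep ι ω c) / e (ι a * ω 0)), Fintype.prod_prod_type]
  simp only [Equiv.neg_apply, ← h1, Finset.prod_mul_distrib, Finset.prod_const, Finset.card_univ,
    Fintype.card_fun, Fintype.card_fin, ← pow_mul, pow_succ]
  rfl

/-- The product formula for the leading coefficient of `φ_t`. -/
theorem leadOf_eq_tprod (h : IsLatticeBasis ι ω δ B) (h' : IsLatticeBasis ι (Fin.tail ω) δ' B')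
    (hm : 1 ≤ m) (hg : Tendsto (paramValue ι ω) cofinite (𝓝 1)) :
    leadOf ι ω X = -leadOf ι (Fin.tail ω) X ^ Fintype.card Fq *
      (latExp (latticeOf ι (Fin.tail ω)) (ω 0))⁻¹ ^ (Fintype.card Fq - 1) *
      ∏' a : {a : Fq[X] // a.Monic},
        (reversedPoly ι (Fin.tail ω) a).eval (latExp (latticeOf ι (Fin.tail ω)) (ω 0))⁻¹ ^
          ((Fintype.card Fq ^ (m + 1) - 1) * (Fintype.card Fq - 1)) := by
  classical
  set e := latExp (latticeOf ι (Fin.tail ω)) with he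
  set D := leadOf ι (Fin.tail ω) X with hD
  set q := Fintype.card Fq with hq
  have hD0 : D ≠ 0 := h'.leadOf_ne_zero X_ne_zero
  have hX : ι X ≠ 0 := h'.norm_coe.ne_zero X_ne_zero
  have he1 : e (ω 0) ≠ 0 := by simpa using h.latExp_ne_zero h' (one_ne_zero (α := Fq[X]))
  obtain ⟨P, hP⟩ := multipliable_of_tendsto_one hg
  have hP0 : P ≠ 0 := hasProd_ne_zero_of_tendsto_one hP hg (paramValue_ne_zero h h' hm)
  have hR : ∀ y : K, ∃ R, HasProd (fun a => 1 + e y / e (ι a * ω 0)) R ∧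
      latExp (latticeOf ι ω) y = e y * R := fun y => by
    obtain ⟨R, hR, hR'⟩ := h.discrete.hasProd_latExp latticeOf_tail_le h.isTransversal_tail y
    refine ⟨R, ?_, hR'⟩
    rw [← (Equiv.neg Fq[X]).hasProd_iff] at hR
    refine hR.congr_fun fun a => ?_
    simp only [Function.comp, Equiv.neg_apply, map_neg, neg_mul]
    rw [h'.discrete.latExp_neg, div_neg, sub_neg_eq_add]
  choose R hR1 hR2 using hR
  have hR0 : R 0 = 1 := by
    refine (hR1 0).unique ?_
    simp [he, latExp, hasProd_one]
  -- Both sides are the product over `a` of `∏_b g(ta + b)`, where `g` is `paramValue`.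
  have hprod : (∏ c : Fin (m + 1) → Fq, R (-divRep ι ω c)) * P ^ q ^ (m + 1) = P := by
    refine HasProd.unique (f := fun a => ∏ b, paramValue ι ω (X * a + C b)) ?_
      (hasProd_X_mul_add hP)
    refine ((hasProd_prod (s := Finset.univ) fun c _ => hR1 (-divRep ι ω c)).mul
      (hP.pow (q ^ (m + 1)))).congr_fun fun a => ?_
    exact (prod_coset_factor h h' hm a).symm
  have hΔ : leadOf ι ω X * ∏ c ∈ Finset.univ.erase (0 : Fin (m + 1) → Fq),
      latExp (latticeOf ι ω) (-divRep ι ω c) = ι X :=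
    leadingCoeff_mulPoly_mul h.discrete h.isTransversal_divRep divRep_zero_mem
  rw [Finset.prod_congr rfl fun c _ => hR2 (-divRep ι ω c), Finset.prod_mul_distrib] at hΔ
  have hRe : ∏ c ∈ Finset.univ.erase (0 : Fin (m + 1) → Fq), R (-divRep ι ω c) =
      ∏ c, R (-divRep ι ω c) := by
    rw [← Finset.mul_prod_erase _ (fun c : Fin (m + 1) → Fq => R (-divRep ι ω c))
      (Finset.mem_univ 0), divRep_zero, neg_zero, hR0, one_mul]
  rw [hRe] at hΔ
  have hE := leadOf_pow_mul_prod_latExp h'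
  rw [← he, ← hD, ← hq] at hE
  set E := ∏ c ∈ Finset.univ.erase (0 : Fin (m + 1) → Fq), e (-divRep ι ω c)
  set RR := ∏ c, R (-divRep ι ω c)
  have hmon : ∏' a : {a : Fq[X] // a.Monic},
      (reversedPoly ι (Fin.tail ω) a).eval (e (ω 0))⁻¹ ^ ((q ^ (m + 1) - 1) * (q - 1)) =
        P ^ (q ^ (m + 1) - 1) := by
    have h1 := (hasProd_monic hP paramValue_zero
      fun a c hc => paramValue_C_mul h.norm_coe hc a).pow (q ^ (m + 1) - 1)
    rw [← h1.tprod_eq]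
    refine tprod_congr fun a => ?_
    rw [← pow_mul, mul_comm, paramValue, if_neg a.2.ne_zero]
  have hqpos : 0 < q ^ (m + 1) := pow_pos Fintype.card_pos _
  have hPP : RR * P ^ (q ^ (m + 1) - 1) = 1 := by
    refine mul_right_cancel₀ hP0 ?_
    rw [mul_assoc, ← pow_succ, Nat.sub_add_cancel hqpos, hprod, one_mul]
  rw [hmon]
  have hw : (e (ω 0))⁻¹ ^ (q - 1) * e (ω 0) ^ (q - 1) = 1 := by
    rw [← mul_pow, inv_mul_cancel₀ he1, one_pow]
  -- Eliminates `E` and `RR` from `Δ E RR = t`, `D^q E = -t e(ω_1)^{q-1}` and `RR P^{q^r-1} = 1`;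
  -- the extra factor `t` avoids dividing by `E`.
  have hfin : leadOf ι ω X * ι X =
      (-D ^ q * (e (ω 0))⁻¹ ^ (q - 1) * P ^ (q ^ (m + 1) - 1)) * ι X := by
    linear_combination (-(D ^ q * (e (ω 0))⁻¹ ^ (q - 1) * P ^ (q ^ (m + 1) - 1))) * hΔ
      + (leadOf ι ω X * RR * (e (ω 0))⁻¹ ^ (q - 1) * P ^ (q ^ (m + 1) - 1)) * hE
      - (ι X * leadOf ι ω X * (e (ω 0))⁻¹ ^ (q - 1) * e (ω 0) ^ (q - 1)) * hPP
      - (ι X * leadOf ι ω X) * hw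
  exact mul_right_cancel₀ hX hfin

end ProductFormula

/-! ### Formal and analytic limits of products of polynomials -/

section Convergence

lemma dvd_prod_sub_one {R κ : Type*} [CommRing R] {d : R} (s : Finset κ) (f : κ → R)
    (h : ∀ i ∈ s, d ∣ f i - 1) : d ∣ ∏ i ∈ s, f i - 1 := by
  classical
  induction s using Finset.induction_on with
  | empty => simp
  | insert i s hi ih =>
    rw [Finset.prod_insert hi, show f i * ∏ j ∈ s, f j - 1 =
      (f i - 1) * ∏ j ∈ s, f j + (∏ j ∈ s, f j - 1) by ring]
    exact dvd_add ((h i (Finset.mem_insert_self _ _)).mul_right _)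
      (ih fun j hj => h j (Finset.mem_insert_of_mem hj))

lemma exists_eventually_coeff_prod_eq {R κ : Type*} [CommRing R] (f : κ → R[X]) (j : ℕ)
    (h : {i | ¬ X ^ (j + 1) ∣ f i - 1}.Finite) :
    ∃ c, ∀ᶠ S : Finset κ in atTop, (∏ i ∈ S, f i).coeff j = c := by
  classical
  refine ⟨(∏ i ∈ h.toFinset, f i).coeff j, (eventually_ge_atTop h.toFinset).mono fun S hS => ?_⟩
  have h1 : X ^ (j + 1) ∣ ∏ i ∈ S, f i - ∏ i ∈ h.toFinset, f i := by
    rw [← Finset.prod_sdiff hS, show (∏ i ∈ S \ h.toFinset, f i) * ∏ i ∈ h.toFinset, f i -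
      ∏ i ∈ h.toFinset, f i = (∏ i ∈ S \ h.toFinset, f i - 1) * ∏ i ∈ h.toFinset, f i by ring]
    refine (dvd_prod_sub_one _ _ fun i hi => ?_).mul_right _
    by_contra hn
    exact (Finset.mem_sdiff.1 hi).2 (h.mem_toFinset.2 hn)
  have h2 := X_pow_dvd_iff.1 h1 j (Nat.lt_succ_self j)
  rwa [coeff_sub, sub_eq_zero] at h2

/-- The coefficientwise limit of a product of polynomials. -/
def prodSeries {R κ : Type*} [CommRing R] (f : κ → R[X]) : PowerSeries R :=
  open Classical in
  PowerSeries.mk fun j =>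
    if h : ∃ c, ∀ᶠ S : Finset κ in atTop, (∏ i ∈ S, f i).coeff j = c then h.choose else 0

lemma eventually_coeff_prodSeries {R κ : Type*} [CommRing R] (f : κ → R[X]) (j : ℕ)
    (h : {i | ¬ X ^ (j + 1) ∣ f i - 1}.Finite) :
    ∀ᶠ S : Finset κ in atTop, (∏ i ∈ S, f i).coeff j = PowerSeries.coeff j (prodSeries f) := by
  have h' := exists_eventually_coeff_prod_eq f j h
  rw [prodSeries, PowerSeries.coeff_mk, dif_pos h']
  exact h'.choose_spec

variable {K : Type*} [NormedField K]

lemma hasSum_coeff_mul_pow (P : K[X]) (u : K) :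
    HasSum (fun j => P.coeff j * u ^ j) (P.eval u) := by
  rw [eval_eq_sum_range]
  refine hasSum_sum_of_ne_finset_zero fun j hj => ?_
  rw [coeff_eq_zero_of_natDegree_lt (by simpa [Nat.lt_succ_iff] using hj), zero_mul]

lemma hasSum_C_mul_X_pow_mul {G : PowerSeries K} {u s : K}
    (h : HasSum (fun j => PowerSeries.coeff j G * u ^ j) s) (c : K) (n : ℕ) :
    HasSum (fun j => PowerSeries.coeff j (PowerSeries.C c * PowerSeries.X ^ n * G) * u ^ j)
      (c * u ^ n * s) := by
  have hinj : Function.Injective fun j : ℕ => j + n := add_left_injective n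
  rw [← hinj.hasSum_iff]
  · refine (h.mul_left (c * u ^ n)).congr_fun fun j => ?_
    simp only [Function.comp]
    rw [mul_assoc (PowerSeries.C c), PowerSeries.coeff_C_mul, PowerSeries.coeff_X_pow_mul, pow_add]
    ring
  · intro j hj
    have : j < n := by
      by_contra hn
      exact hj ⟨j - n, Nat.sub_add_cancel (not_lt.1 hn)⟩
    rw [mul_assoc (PowerSeries.C c), PowerSeries.coeff_C_mul, PowerSeries.coeff_X_pow_mul',
      if_neg (not_le.2 this), mul_zero, zero_mul]

lemma norm_coeff_mul_pow_le {x u : K} {M : ℝ} (hM0 : 0 ≤ M) (hu : ‖u‖ * M ≤ 1 / 2) {j : ℕ}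
    (hx : ‖x‖ ≤ M ^ j) : ‖x * u ^ j‖ ≤ (1 / 2) ^ j := by
  rw [norm_mul, norm_pow]
  calc ‖x‖ * ‖u‖ ^ j ≤ M ^ j * ‖u‖ ^ j := by gcongr
    _ = (‖u‖ * M) ^ j := by rw [mul_pow, mul_comm]
    _ ≤ (1 / 2) ^ j := pow_le_pow_left₀ (by positivity) hu _

variable [IsUltrametricDist K] [CompleteSpace K]

/-- Every partial product has `j`-th term at most `2^{-j}` at `u`, so dominated convergence allows
the limit over finite subsets to be taken term by term. -/
lemma hasSum_prodSeries {κ : Type*} {f : κ → K[X]} {M : ℝ} (hM : 0 ≤ M)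
    (hf : ∀ i j, ‖(f i).coeff j‖ ≤ M ^ j)
    (h : ∀ j, {i | ¬ X ^ (j + 1) ∣ f i - 1}.Finite) {u P : K} (hu : ‖u‖ * M ≤ 1 / 2)
    (hP : HasProd (fun i => (f i).eval u) P) :
    HasSum (fun j => PowerSeries.coeff j (prodSeries f) * u ^ j) P := by
  have hb : ∀ (S : Finset κ) j, ‖(∏ i ∈ S, f i).coeff j * u ^ j‖ ≤ (1 / 2) ^ j := fun S j =>
    norm_coeff_mul_pow_le hM hu (norm_coeff_prod_le S f hM (fun i _ => hf i) j)
  have hs : Summable fun j : ℕ => (1 / 2 : ℝ) ^ j := summable_geometric_two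
  have hev := fun j => eventually_coeff_prodSeries f j (h j)
  have hb' : ∀ j, ‖PowerSeries.coeff j (prodSeries f) * u ^ j‖ ≤ (1 / 2) ^ j := fun j => by
    obtain ⟨S, hS⟩ := (hev j).exists
    rw [← hS]
    exact hb S j
  have hsum : Summable fun j => PowerSeries.coeff j (prodSeries f) * u ^ j :=
    Summable.of_norm_bounded hs hb'
  have ht := tendsto_tsum_of_dominated_convergence (𝓕 := (atTop : Filter (Finset κ)))
    (f := fun S j => (∏ i ∈ S, f i).coeff j * u ^ j)
    (g := fun j => PowerSeries.coeff j (prodSeries f) * u ^ j) hs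
    (fun j => tendsto_const_nhds.congr' ((hev j).mono fun S hS => by simp only [hS]))
    (Eventually.of_forall hb)
  have ht' : Tendsto (fun S : Finset κ => ∏ i ∈ S, (f i).eval u) atTop (𝓝 P) := by
    simpa [HasProd] using hP
  have : P = ∑' j, PowerSeries.coeff j (prodSeries f) * u ^ j := by
    refine tendsto_nhds_unique ht' (ht.congr fun S => ?_)
    rw [(hasSum_coeff_mul_pow _ u).tsum_eq, eval_prod]
  rw [this]
  exact hsum.hasSum

end Convergence

/-! ### Uniform decay of `f_a(u)` in `deg a` -/

section ReversedPolynomials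

variable {Fq : Type*} [Field Fq] [Fintype Fq] {K : Type*} [NormedField K] [IsUltrametricDist K]
  [CompleteSpace K] {ι : Fq[X] →+* K} {n : ℕ} {ω : Fin n → K} {δ B : ℝ}

namespace IsLatticeBasis

lemma X_pow_dvd_reversedPoly_sub_one (h : IsLatticeBasis ι ω δ B) (hn : 1 ≤ n) {a : Fq[X]}
    (ha : a ≠ 0) {j : ℕ} (hj : 2 * j ≤ a.natDegree) : X ^ (j + 1) ∣ reversedPoly ι ω a - 1 := by
  rw [X_pow_dvd_iff]
  intro i hi
  rw [coeff_sub, coeff_one]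
  split_ifs with h0
  · rw [h0, h.coeff_reversedPoly_zero hn ha, sub_self]
  · rw [h.coeff_reversedPoly_eq_zero ha h0, sub_zero]
    have h1 : a.natDegree < Fintype.card Fq ^ a.natDegree := Nat.lt_pow_self Fintype.one_lt_card
    have h2 : Fintype.card Fq ^ a.natDegree ≤ Fintype.card Fq ^ (n * a.natDegree) :=
      Nat.pow_le_pow_right Fintype.card_pos (Nat.le_mul_of_pos_left _ hn)
    omega

lemma finite_not_dvd (h : IsLatticeBasis ι ω δ B) (hn : 1 ≤ n) (E j : ℕ) :
    {a : {a : Fq[X] // a.Monic} | ¬ X ^ (j + 1) ∣ reversedPoly ι ω a ^ E - 1}.Finite := by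
  refine ((finite_natDegree_le (R := Fq) (2 * j)).preimage Subtype.val_injective.injOn).subset
    fun a ha => ?_
  by_contra hn'
  refine ha ((h.X_pow_dvd_reversedPoly_sub_one hn a.2.ne_zero (j := j) ?_).trans ?_)
  · simp only [Set.mem_preimage, Set.mem_ofPred_eq, not_le] at hn'
    exact hn'.le
  · simpa using sub_dvd_pow_sub_pow (reversedPoly ι ω a) 1 E

/-- Non-constant terms of degree at most `deg a / 2` vanish and the `j`-th term is at most `2^{-j}`.
The bound depends on `a` through its degree only, and not on `ω`. -/
lemma norm_eval_reversedPoly_sub_one_le (h : IsLatticeBasis ι ω δ B) (hn : 1 ≤ n) {a : Fq[X]}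
    (ha : a ≠ 0) {M : ℝ} (hM : 0 ≤ M)
    (hb : ∀ z : K, ‖z‖ ≤ B → ‖latExp (latticeOf ι ω) z‖ ≤ M) {u : K} (hu : ‖u‖ * M ≤ 1 / 2) :
    ‖(reversedPoly ι ω a).eval u - 1‖ ≤ (1 / 2) ^ (a.natDegree / 2 + 1) := by
  rw [eval_eq_sum_range, Finset.sum_range_succ', pow_zero, mul_one, h.coeff_reversedPoly_zero hn ha,
    add_sub_cancel_right]
  refine norm_sum_le_of_forall_le _ _ (by positivity) fun j _ => ?_
  rcases le_or_gt (a.natDegree / 2 + 1) (j + 1) with hj | hj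
  · refine (norm_coeff_mul_pow_le hM hu (h.norm_coeff_reversedPoly_le hn ha hM hb _)).trans ?_
    exact pow_le_pow_of_le_one (by norm_num) (by norm_num) hj
  · have h1 := X_pow_dvd_iff.1 (h.X_pow_dvd_reversedPoly_sub_one hn ha
      (j := a.natDegree / 2) (by omega)) (j + 1) hj
    rw [coeff_sub, coeff_one, if_neg (by omega), sub_zero] at h1
    rw [h1, zero_mul, norm_zero]
    positivity

end IsLatticeBasis

lemma norm_pow_sub_one_le {K : Type*} [NormedField K] [IsUltrametricDist K] {x : K} {ε : ℝ}
    (h0 : 0 ≤ ε) (h1 : ε ≤ 1) (h : ‖x - 1‖ ≤ ε) (E : ℕ) : ‖x ^ E - 1‖ ≤ ε := by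
  simpa using norm_prod_sub_one_le (Finset.range E) (fun _ => x) h0 h1 fun _ _ => h

lemma finite_natDegree_of_le_pow (R : Type*) [Semiring R] [Finite R] {ε : ℝ} (hε : 0 < ε) :
    {a : R[X] | ε ≤ (1 / 2) ^ (a.natDegree / 2 + 1)}.Finite := by
  obtain ⟨N, hN⟩ := exists_pow_lt_of_lt_one hε (by norm_num : (1 / 2 : ℝ) < 1)
  refine (finite_natDegree_le (2 * N)).subset fun a ha => ?_
  by_contra hn
  simp only [Set.mem_ofPred_eq, not_le] at hn ha
  refine absurd (ha.trans ?_) (not_le.2 hN)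
  exact pow_le_pow_of_le_one (by norm_num) (by norm_num) (by omega)

lemma multipliableUniformlyOn_reversedPoly (hn : 1 ≤ n) (E : ℕ) {M : ℝ} (hM : 0 ≤ M)
    {s : Set (K × (Fin n → K))}
    (hs : ∀ x ∈ s, ‖x.1‖ * M ≤ 1 / 2 ∧ IsLatticeBasis ι x.2 δ B ∧
      ∀ z : K, ‖z‖ ≤ B → ‖latExp (latticeOf ι x.2) z‖ ≤ M) :
    MultipliableUniformlyOn (fun (a : {a : Fq[X] // a.Monic}) (x : K × (Fin n → K)) =>
      (reversedPoly ι x.2 a).eval x.1 ^ E) s := by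
  have key : ∀ (a : {a : Fq[X] // a.Monic}), ∀ x ∈ s,
      ‖(reversedPoly ι x.2 a).eval x.1 ^ E - 1‖ ≤ (1 / 2) ^ ((a : Fq[X]).natDegree / 2 + 1) :=
    fun a x hx => by
      obtain ⟨h1, h2, h3⟩ := hs x hx
      exact norm_pow_sub_one_le (by positivity) (pow_le_one₀ (by norm_num) (by norm_num))
        (h2.norm_eval_reversedPoly_sub_one_le hn a.2.ne_zero hM h3 h1) E
  refine multipliableUniformlyOn_of_finite (fun a x hx => ?_) fun ε hε => ?_
  · refine (norm_eq_one_of_norm_sub_one_lt ((key a x hx).trans_lt ?_)).le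
    exact pow_lt_one₀ (by norm_num) (by norm_num) (by omega)
  · refine ((finite_natDegree_of_le_pow Fq hε).preimage Subtype.val_injective.injOn).subset ?_
    rintro a ⟨x, hx, hx'⟩
    exact hx'.trans (key a x hx)

lemma tendsto_paramValue {m : ℕ} {ω : Fin (m + 1) → K}
    (h' : IsLatticeBasis ι (Fin.tail ω) δ B) (hm : 1 ≤ m) {M : ℝ} (hM : 0 ≤ M)
    (hb : ∀ z : K, ‖z‖ ≤ B → ‖latExp (latticeOf ι (Fin.tail ω)) z‖ ≤ M)
    (hu : ‖(latExp (latticeOf ι (Fin.tail ω)) (ω 0))⁻¹‖ * M ≤ 1 / 2) :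
    Tendsto (paramValue ι ω) cofinite (𝓝 1) := by
  refine Metric.tendsto_nhds.2 fun ε hε => ?_
  rw [Filter.eventually_cofinite]
  refine (finite_natDegree_of_le_pow Fq hε).subset fun a ha => ?_
  rw [Set.mem_ofPred_eq, not_lt, dist_eq_norm] at ha
  refine ha.trans ?_
  rcases eq_or_ne a 0 with rfl | ha0
  · rw [paramValue_zero, sub_self, norm_zero]; positivity
  · rw [paramValue, if_neg ha0]
    exact h'.norm_eval_reversedPoly_sub_one_le hm ha0 hM hb hu

end ReversedPolynomials

/-! ### Specialization to `C_∞` and the domains `Ω^n_k` -/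

section Concrete

variable (Fq : Type*) [Field Fq] [Fintype Fq]

instance : IsUltrametricDist (AlgClInfty Fq) :=
  IsUltrametricDist.isUltrametricDist_of_forall_norm_add_le_max_norm
    (isNonarchimedean_spectralNorm (K := FInfty Fq) (L := AlgClInfty Fq))

instance : IsUltrametricDist (CInfty Fq) := by
  apply IsUltrametricDist.isUltrametricDist_of_forall_norm_add_le_max_norm
  intro x y
  induction x, y using UniformSpace.Completion.induction_on₂ with
  | hp => exact isClosed_le (by fun_prop) (by fun_prop)
  | ih a b =>
    rw [← UniformSpace.Completion.coe_add]
    simp only [UniformSpace.Completion.norm_coe]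
    exact IsUltrametricDist.norm_add_le_max a b

/-- The embedding `A → F_∞`. -/
def polyToFInfty : Fq[X] →+* FInfty Fq :=
  (UniformSpace.Completion.coeRingHom (α := WithAbs (absInfty Fq))).comp <|
    (WithAbs.equiv (absInfty Fq)).symm.toRingHom.comp (algebraMap Fq[X] (RatFunc Fq))

lemma norm_polyToFInfty {a : Fq[X]} (ha : a ≠ 0) :
    ‖polyToFInfty Fq a‖ = (Fintype.card Fq : ℝ) ^ a.natDegree := by
  have h : ‖polyToFInfty Fq a‖ = absInfty Fq (algebraMap Fq[X] (RatFunc Fq) a) :=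
    UniformSpace.Completion.norm_coe _
  rw [h, absInfty_of_ne_zero Fq (by simpa using ha), RatFunc.intDegree_polynomial, zpow_natCast]

lemma ofPoly_eq (a : Fq[X]) :
    ofPoly Fq a = algebraMap (FInfty Fq) (CInfty Fq) (polyToFInfty Fq a) := rfl

lemma norm_ofPoly (a : Fq[X]) : ‖ofPoly Fq a‖ = ‖polyToFInfty Fq a‖ := by
  rw [ofPoly_eq, norm_algebraMap']

lemma isNormAtInfinity_ofPoly : IsNormAtInfinity (ofPoly Fq) := fun a ha => by
  rw [norm_ofPoly, norm_polyToFInfty Fq ha]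

variable {Fq}

lemma isLatticeBasis_of_lower {n : ℕ} {ω : Fin n → CInfty Fq} {δ B : ℝ} (hδ : 0 < δ) (hB : ‖ω‖ ≤ B)
    (h : ∀ x : Fin n → FInfty Fq, δ * ‖x‖ ≤ ‖∑ j, algebraMap (FInfty Fq) (CInfty Fq) (x j) * ω j‖) :
    IsLatticeBasis (ofPoly Fq) ω δ B where
  norm_coe := isNormAtInfinity_ofPoly Fq
  pos := hδ
  lower a i := by
    refine (mul_le_mul_of_nonneg_left ?_ hδ.le).trans (h fun j => polyToFInfty Fq (a j))
    rw [norm_ofPoly]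
    exact norm_le_pi_norm (fun j => polyToFInfty Fq (a j)) i
  nonneg := (norm_nonneg _).trans hB
  upper i := (norm_le_pi_norm ω i).trans hB

/-- An injective linear map from a finite-dimensional space over a complete field is bounded below.
The constants depend on `ω`, which suffices where no uniformity is needed. -/
lemma exists_isLatticeBasis {ξ : CInfty Fq} {n : ℕ} {ω : Fin n → CInfty Fq}
    (h : ω ∈ periodDomain ξ n) : ∃ δ B, IsLatticeBasis (ofPoly Fq) ω δ B := by
  have hker : (Fintype.linearCombination (FInfty Fq) ω).ker = ⊥ :=
    LinearMap.ker_eq_bot.2 (linearIndependent_iff_injective_fintypeLinearCombination.1 h.1)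
  obtain ⟨c, hc, hanti⟩ := LinearMap.exists_antilipschitzWith _ hker
  refine ⟨(c : ℝ)⁻¹, ‖ω‖, isLatticeBasis_of_lower (by positivity) le_rfl fun x => ?_⟩
  have h1 := hanti.le_mul_dist x 0
  rw [map_zero, dist_zero_right, dist_zero_right, Fintype.linearCombination_apply] at h1
  rw [inv_mul_le_iff₀ (by exact_mod_cast hc)]
  simpa only [Algebra.smul_def] using h1

lemma hyperplaneDist_mul_le {n : ℕ} (ω : Fin n → CInfty Fq) (x : Fin n → FInfty Fq) :
    hyperplaneDist ω * ‖x‖ ≤ ‖∑ j, algebraMap (FInfty Fq) (CInfty Fq) (x j) * ω j‖ := by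
  rcases eq_or_ne x 0 with rfl | hx
  · simp
  have hx' : 0 < ‖x‖ := norm_pos_iff.2 hx
  obtain ⟨i, hi⟩ : ∃ i, ‖x i‖ = ‖x‖ := by
    have : Nonempty (Fin n) := by
      by_contra hn
      rw [not_nonempty_iff] at hn
      exact hx (Subsingleton.elim _ _)
    obtain ⟨i, hi⟩ := Finite.exists_max fun i => ‖x i‖
    exact ⟨i, le_antisymm (norm_le_pi_norm x i) ((pi_norm_le_iff_of_nonneg (norm_nonneg _)).2 hi)⟩
  have hi0 : x i ≠ 0 := fun h0 => by rw [h0, norm_zero] at hi; exact hx'.ne hi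
  have h1 : ‖(x i)⁻¹ • x‖ = 1 := by
    rw [norm_smul, norm_inv, hi, inv_mul_cancel₀ hx'.ne']
  have h2 : hyperplaneDist ω ≤
      ‖∑ j, algebraMap (FInfty Fq) (CInfty Fq) (((x i)⁻¹ • x) j) * ω j‖ :=
    ciInf_le (f := fun h : {h : Fin n → FInfty Fq // ‖h‖ = 1} =>
      ‖∑ j, algebraMap (FInfty Fq) (CInfty Fq) ((h : Fin n → FInfty Fq) j) * ω j‖)
      ⟨0, by rintro _ ⟨_, rfl⟩; exact norm_nonneg _⟩ ⟨_, h1⟩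
  have h3 : ∑ j, algebraMap (FInfty Fq) (CInfty Fq) (((x i)⁻¹ • x) j) * ω j =
      algebraMap (FInfty Fq) (CInfty Fq) (x i)⁻¹ *
        ∑ j, algebraMap (FInfty Fq) (CInfty Fq) (x j) * ω j := by
    rw [Finset.mul_sum]
    refine Finset.sum_congr rfl fun j _ => ?_
    rw [Pi.smul_apply, smul_eq_mul, map_mul, mul_assoc]
  rw [h3, norm_mul, norm_algebraMap', norm_inv, hi, le_inv_mul_iff₀ hx', mul_comm] at h2
  exact h2

/-- The entry `ξ` gives `|ω|_i ≤ |ξ| ≤ |ω|`. With `|ω|_i ≥ q^{-k} |ω|` this bounds `|ω|_i` below and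
`|ω|` above in terms of `k` and `ξ` only. -/
lemma isLatticeBasis_of_mem_level {ξ : CInfty Fq} (hξ : ξ ≠ 0) {m k : ℕ} (hm : 1 ≤ m)
    {ω : Fin m → CInfty Fq} (h : ω ∈ periodDomainLevel ξ m k) :
    IsLatticeBasis (ofPoly Fq) ω (((Fintype.card Fq : ℝ) ^ k)⁻¹ * ‖ξ‖)
      ((Fintype.card Fq : ℝ) ^ k * ‖ξ‖) := by
  obtain ⟨m, rfl⟩ : ∃ l, m = l + 1 := ⟨m - 1, by omega⟩
  have hq : (0 : ℝ) < (Fintype.card Fq : ℝ) ^ k := pow_pos (one_pos.trans (one_lt_card Fq)) k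
  have hlast : ω (Fin.last m) = ξ := h.1.2 _ (by simp)
  have h1 : ‖ξ‖ ≤ ‖ω‖ := hlast ▸ norm_le_pi_norm ω (Fin.last m)
  have h2 : hyperplaneDist ω ≤ ‖ξ‖ := by
    have := hyperplaneDist_mul_le ω (Pi.single (Fin.last m) 1)
    rw [Finset.sum_eq_single (Fin.last m) (fun j _ hj => by simp [hj]) (by simp)] at this
    simpa [hlast, Pi.norm_single] using this
  refine isLatticeBasis_of_lower (by positivity) ?_ fun x => ?_
  · have := h.2.trans h2
    rwa [inv_mul_le_iff₀ hq] at this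
  · refine (mul_le_mul_of_nonneg_right ?_ (norm_nonneg x)).trans (hyperplaneDist_mul_le ω x)
    exact (mul_le_mul_of_nonneg_left h1 (by positivity)).trans h.2

lemma one_add_fPoly {m : ℕ} (ω : Fin m → CInfty Fq) (a : Fq[X]) :
    1 + fPoly ω a = reversedPoly (ofPoly Fq) ω a := add_sub_cancel _ _

lemma one_add_eval_fPoly {m : ℕ} (ω : Fin m → CInfty Fq) (a : Fq[X]) (u : CInfty Fq) :
    1 + (fPoly ω a).eval u = (reversedPoly (ofPoly Fq) ω a).eval u := by
  rw [← one_add_fPoly, eval_add, eval_one]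

lemma leadCoeff_eq {m : ℕ} (ω : Fin m → CInfty Fq) (a : Fq[X]) :
    leadCoeff a ω = leadOf (ofPoly Fq) ω a := rfl

lemma leadCoeff_X_of_isCarlitzGenerator {ξ : CInfty Fq} (h : IsCarlitzGenerator ξ)
    {ω : Fin 1 → CInfty Fq} (hω : ω ∈ periodDomain ξ 1) : leadCoeff (X : Fq[X]) ω = 1 := by
  have h1 : ω = ![ξ] := by
    ext i
    rw [Subsingleton.elim i 0]
    exact hω.2 0 (by simp)
  rw [leadCoeff, h1, h.2]
  have hq : 1 < Fintype.card Fq := Fintype.one_lt_card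
  rw [leadingCoeff_add_of_degree_lt, leadingCoeff_X_pow]
  refine (degree_C_mul_X_le _).trans_lt ?_
  rw [degree_X_pow]
  exact_mod_cast hq

lemma fPoly_C_mul {m : ℕ} (ω : Fin m → CInfty Fq) {c : Fq} (hc : c ≠ 0) (p : Fq[X]) :
    fPoly ω (C c * p) = fPoly ω p := by
  rw [← add_right_inj (1 : (CInfty Fq)[X]), one_add_fPoly, one_add_fPoly,
    reversedPoly_C_mul (isNormAtInfinity_ofPoly Fq) hc]

end Concrete

end DrinfeldDisc
end

/-! ### The main theorem -/

open DrinfeldDisc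
theorem mainTheorem2 {Fq : Type*} [Field Fq] [Fintype Fq] (q : ℕ) (hq : Fintype.card Fq = q)
    (ξ : CInfty Fq) (hξ : ξ ≠ 0) (m : ℕ) (hm : 1 ≤ m) :
    -- `f_{cp} = f_p`
    (∀ ω' ∈ periodDomain ξ m, ∀ c : Fq, c ≠ 0 → ∀ p : Fq[X],
      fPoly ω' (C c * p) = fPoly ω' p) ∧
    -- the normalization of `Δ'` in rank `r = m + 1 = 2`
    (m = 1 → IsCarlitzGenerator ξ → ∀ ω' ∈ periodDomain ξ m, leadCoeff (X : Fq[X]) ω' = 1) ∧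
    -- the product over monic polynomials, as a formal power series (converging `u`-adically) ...
    ∃ G : (Fin m → CInfty Fq) → PowerSeries (CInfty Fq),
      (∀ ω' ∈ periodDomain ξ m, ∀ j : ℕ,
        ∀ᶠ S : Finset {a : Fq[X] // a.Monic} in atTop,
          (∏ a ∈ S, (1 + fPoly ω' (a : Fq[X])) ^ ((q ^ (m + 1) - 1) * (q - 1))).coeff j =
            (G ω').coeff j) ∧
      -- ... and as a uniformly convergent product of functions
      ∀ k : ℕ, ∃ ρ : ℝ, 0 < ρ ∧
        MultipliableUniformlyOn
          (fun (a : {a : Fq[X] // a.Monic}) (x : CInfty Fq × (Fin m → CInfty Fq)) =>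
            (1 + (fPoly x.2 (a : Fq[X])).eval x.1) ^ ((q ^ (m + 1) - 1) * (q - 1)))
          (Metric.ball 0 ρ ×ˢ periodDomainLevel ξ m k) ∧
        ∀ ω ∈ periodDomain ξ (m + 1), Fin.tail ω ∈ periodDomainLevel ξ m k →
          ‖uParam (Fin.tail ω) (ω 0)‖ < ρ →
          leadCoeff (X : Fq[X]) ω =
              -(leadCoeff (X : Fq[X]) (Fin.tail ω)) ^ q * uParam (Fin.tail ω) (ω 0) ^ (q - 1) *
                ∏' a : {a : Fq[X] // a.Monic},
                  (1 + (fPoly (Fin.tail ω) (a : Fq[X])).eval (uParam (Fin.tail ω) (ω 0))) ^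
                    ((q ^ (m + 1) - 1) * (q - 1)) ∧
            HasSum
              (fun j : ℕ =>
                (PowerSeries.C (-(leadCoeff (X : Fq[X]) (Fin.tail ω)) ^ q) * PowerSeries.X ^ (q - 1) *
                  G (Fin.tail ω)).coeff j * uParam (Fin.tail ω) (ω 0) ^ j)
              (leadCoeff (X : Fq[X]) ω) := by
  subst hq
  refine ⟨fun ω' _ c hc p => fPoly_C_mul ω' hc p, ?_,
    fun ω' => prodSeries fun a : {a : Fq[X] // a.Monic} => reversedPoly (ofPoly Fq) ω' a ^
      ((Fintype.card Fq ^ (m + 1) - 1) * (Fintype.card Fq - 1)), fun ω' hω' j => ?_, fun k => ?_⟩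
  · rintro rfl hC ω' hω'
    exact leadCoeff_X_of_isCarlitzGenerator hC hω'
  · obtain ⟨δ, B, h⟩ := exists_isLatticeBasis hω'
    simp only [one_add_fPoly]
    exact eventually_coeff_prodSeries _ j (h.finite_not_dvd hm _ j)
  have hδ : 0 < ((Fintype.card Fq : ℝ) ^ k)⁻¹ * ‖ξ‖ :=
    mul_pos (inv_pos.2 (pow_pos (one_pos.trans (one_lt_card Fq)) k)) (norm_pos_iff.2 hξ)
  obtain ⟨M, hM1, hM⟩ := exists_norm_latExp_le (ofPoly Fq) m (isNormAtInfinity_ofPoly Fq) hδ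
    (B := (Fintype.card Fq : ℝ) ^ k * ‖ξ‖)
  have hM0 : 0 < M := one_pos.trans_le hM1
  have hρ : ∀ u : CInfty Fq, ‖u‖ < 1 / 2 / M → ‖u‖ * M ≤ 1 / 2 := fun u hu =>
    ((lt_div_iff₀ hM0).1 hu).le
  have hunif := multipliableUniformlyOn_reversedPoly (ι := ofPoly Fq) hm
    ((Fintype.card Fq ^ (m + 1) - 1) * (Fintype.card Fq - 1)) hM0.le
    (s := Metric.ball 0 (1 / 2 / M) ×ˢ periodDomainLevel ξ m k) fun x hx => by
      have h := isLatticeBasis_of_mem_level hξ hm hx.2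
      exact ⟨hρ _ (mem_ball_zero_iff.1 hx.1), h, hM _ h⟩
  -- The radius ensures `|u| M ≤ 1/2`, with `M` uniform on `Ω^m_k`.
  refine ⟨1 / 2 / M, by positivity, ?_, fun ω hω hω' hu => ?_⟩
  · simpa only [one_add_eval_fPoly] using hunif
  · obtain ⟨δ, B, h⟩ := exists_isLatticeBasis hω
    have h' := isLatticeBasis_of_mem_level hξ hm hω'
    have hu' := hρ _ hu
    have hform := leadOf_eq_tprod h h' hm (tendsto_paramValue h' hm hM0.le (hM _ h') hu')
    have hprod := (hunif.multipliable
      (x := (uParam (Fin.tail ω) (ω 0), Fin.tail ω)) ⟨mem_ball_zero_iff.2 hu, hω'⟩).hasProd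
    simp only [one_add_eval_fPoly]
    refine ⟨hform, ?_⟩
    rw [leadCoeff_eq ω, hform]
    refine hasSum_C_mul_X_pow_mul ?_ _ _
    refine hasSum_prodSeries hM0.le (fun a j => ?_) (fun j => h'.finite_not_dvd hm _ j) hu' ?_
    · simpa using norm_coeff_prod_le (Finset.range _) (fun _ => reversedPoly _ _ (a : Fq[X]))
        hM0.le (fun _ _ => h'.norm_coeff_reversedPoly_le hm a.2.ne_zero hM0.le (hM _ h')) j
    · simp only [eval_pow]
      exact hprod
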